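/- Let $F$ be a finite field with $q$ elements and consider one of the following three independent cases, in each of which $V$ is a finite-dimensional $F$-vector space with a nondegenerate form $\langle\cdot,\cdot\rangle\colon V\times V\to F$. * (uH) $F/F_0$ is a quadratic extension, $q_0=\#F_0$ (so $q=q_0^2$), and the form is $F/F_0$-Hermitian. Put $\gamma=1$, $\mathrm{Sign}=\{1\}$. * (S) $q$ is odd and the form is symmetric. Put $\gamma=1$, $\mathrm{Sign}=F^\times/(F^\times)^2=\{\pm1\}$. * (A) The form is alternating. Put $\gamma=2$, $\mathrm{Sign}=\{1\}$. Let $\mathrm{sign}\colon F^\times\to\mathrm{Sign}$ be the natural map (the quadratic character in case (S), trivial in the other cases) and $\epsilon=\mathrm{sign}(-1)$. The type of a nondegenerate space $W$ is $\mathrm{typ}(W)=(d,\chi)$, where $d=\frac1\gamma\dim_F W$ and $\chi\in\mathrm{Sign}$ is the sign of the Gram determinant of the form in any basis of $W$. (In cases (uH) and (A) always $\chi=1$.) For $n\ge 0$ write $(n)_x=\prod_{i=1}^n(x^i-1)$, and in case (S) put $e(r,\chi)=q^{r/2}+\epsilon^{r/2}\chi$ if $r$ is even and $e(r,\chi)=1$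 if $r$ is odd. **Theorem.** Let $\mathrm{typ}(V)=(r,\chi)$. Let $0\le m,n\le r$ be integers and $\psi_1\in\mathrm{Sign}$, and put $$l=r-n-\tfrac{2}{\gamma}m,\qquad \psi_2=\chi\,\psi_1\,\epsilon^m .$$ Then the number of subspaces $N\subseteq V$ such that $\dim(N\cap N^\perp)=m$ and $N/(N\cap N^\perp)$, with the induced form, has type $(n,\psi_1)$ is equal to $0$ if $l<0$, and if $l\ge0$ it is equal to $$Q(n,\psi_1,m,l,\psi_2)=\begin{cases} \displaystyle(-1)^m(-q_0)^{nl}\,\frac{(r)_{-q_0}}{(n)_{-q_0}\,(m)_{q_0^2}\,(l)_{-q_0}} & \text{in case (uH)},\\[3mm] \displaystyle\frac{q^{\lfloor nl/2\rfloor}}{2}\,\frac{(\lfloor r/2\rfloor)_{q^2}}{(\lfloor n/2\rfloor)_{q^2}\,(m)_{q}\,(\lfloor l/2\rfloor)_{q^2}}\cdot\frac{e(n,\psi_1)\,e(l,\psi_2)}{e(r,\chi)} & \text{in case (S)},\\[3mm] \displaystyle q^{2nl}\,\frac{(r)_{q^2}}{(n)_{q^2}\,(m)_{q}\,(l)_{q^2}}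 & \text{in case (A)}. \end{cases}$$ -/

import Mathlib

/-- The three (independent) cases: Hermitian, symmetric and alternating forms. -/
inductive FormCase : Type
  | hermitian
  | symmetric
  | alternating

namespace FormCase

/-- The normalising constant `γ`: `2` in the alternating case and `1` otherwise. -/
def gamma : FormCase → ℕ
  | hermitian => 1
  | symmetric => 1
  | alternating => 2

/-- The set of signs: `{1, -1}` in the symmetric case and `{1}` otherwise. -/
def Sign : FormCase → Set ℤ
  | hermitian => {1}
  | symmetric => {1, -1}
  | alternating => {1}

/-- The sign of a nonzero element `a` of the finite field `F`: in the symmetric case the class of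
`a` in `Fˣ / (Fˣ)² = {1, -1}`, and `1` in the other cases. -/
def sign (F : Type*) [Field F] [Fintype F] [DecidableEq F] (c : FormCase) (a : F) : ℤ :=
  match c with
  | hermitian => 1
  | symmetric => quadraticChar F a
  | alternating => 1

/-- The condition that `B` is a form of the given kind on an `F`-vector space `V`, where `σ` is the
automorphism of `F` for which `B` is sesquilinear:
* Hermitian: `F / F₀` is quadratic, `σ` is its nontrivial automorphism and `B` is `F/F₀`-Hermitian;
* symmetric: `F = F₀` has odd characteristic, `σ` is trivial and `B` is symmetric;
* alternating: `F = F₀`, `σ` is trivial and `B` is alternating. -/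
def IsForm (F₀ : Type*) {F V : Type*} [Field F₀] [Field F] [Algebra F₀ F]
    [AddCommGroup V] [Module F V] (c : FormCase) (σ : F →+* F)
    (B : V →ₛₗ[σ] V →ₗ[F] F) : Prop :=
  match c with
  | hermitian => Module.finrank F₀ F = 2 ∧ (∀ a : F₀, σ (algebraMap F₀ F a) = algebraMap F₀ F a) ∧
      σ ≠ RingHom.id F ∧ ∀ x y, σ (B x y) = B y x
  | symmetric => Module.finrank F₀ F = 1 ∧ ringChar F ≠ 2 ∧ σ = RingHom.id F ∧
      ∀ x y, B x y = B y x
  | alternating => Module.finrank F₀ F = 1 ∧ σ = RingHom.id F ∧ ∀ x, B x x = 0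

theorem IsForm.isRefl {F₀ F V : Type*} [Field F₀] [Field F] [Algebra F₀ F]
    [AddCommGroup V] [Module F V] {c : FormCase} {σ : F →+* F}
    {B : V →ₛₗ[σ] V →ₗ[F] F} (hB : c.IsForm F₀ σ B) : B.IsRefl := by
  cases c with
  | hermitian =>
    intro x y h
    rw [← hB.2.2.2 x y, h, map_zero]
  | symmetric =>
    intro x y h
    rw [← hB.2.2.2 x y, h]
  | alternating =>
    obtain ⟨-, rfl, h⟩ := hB
    exact LinearMap.IsAlt.isRefl h

/-- The space `(V, B)` is nondegenerate of type `(d, χ)`: the dimension of `V` is `γ d` and the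
Gram determinant of `B` in a basis has sign `χ`. (The sign does not depend on the basis, see
`sign_det_gram_eq`.) -/
def HasType {F V : Type*} [Field F] [Fintype F] [DecidableEq F] [AddCommGroup V] [Module F V]
    (c : FormCase) {σ : F →+* F} (B : V →ₛₗ[σ] V →ₗ[F] F) (d : ℕ) (χ : ℤ) : Prop :=
  B.Nondegenerate ∧ ∃ b : Module.Basis (Fin (c.gamma * d)) F V,
    c.sign F (Matrix.det (Matrix.of fun i j => B (b i) (b j))) = χ

theorem sign_det_gram_eq {F₀ F V : Type*} [Field F₀] [Field F] [Algebra F₀ F]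
    [Fintype F] [DecidableEq F] [AddCommGroup V] [Module F V] {c : FormCase} {σ : F →+* F}
    {B : V →ₛₗ[σ] V →ₗ[F] F} (hB : c.IsForm F₀ σ B) {n : ℕ} (b b' : Module.Basis (Fin n) F V) :
    c.sign F (Matrix.det (Matrix.of fun i j => B (b i) (b j))) =
      c.sign F (Matrix.det (Matrix.of fun i j => B (b' i) (b' j))) := by
  cases c with
  | hermitian => rfl
  | alternating => rfl
  | symmetric =>
    obtain ⟨-, -, rfl, -⟩ := hB
    have h1 : ∀ b : Module.Basis (Fin n) F V,
        (Matrix.of fun i j => B (b i) (b j)) = LinearMap.BilinForm.toMatrix b B := by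
      intro b
      ext i j
      rw [LinearMap.BilinForm.toMatrix_apply, Matrix.of_apply]
    have h2 := LinearMap.BilinForm.toMatrix_mul_basis_toMatrix b b' B
    have h3 : (b.toMatrix b').det ≠ 0 := by
      have := congrArg Matrix.det (b.toMatrix_mul_toMatrix_flip b')
      rw [Matrix.det_mul, Matrix.det_one] at this
      exact left_ne_zero_of_mul_eq_one this
    rw [h1 b, h1 b', ← h2]
    simp only [sign, Matrix.det_mul, Matrix.det_transpose, map_mul]
    have h4 := quadraticChar_sq_one h3
    linear_combination (-(quadraticChar F (LinearMap.BilinForm.toMatrix b B).det)) * h4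

end FormCase

/-- The radical `N ∩ N^⊥` of a subspace `N`, as a subspace of `V`. -/
def formRadical {F V : Type*} [Field F] [AddCommGroup V] [Module F V] {σ : F →+* F}
    (B : V →ₛₗ[σ] V →ₗ[F] F) (N : Submodule F V) : Submodule F V :=
  N ⊓ N.orthogonalBilin B

theorem formRadical_le_ker {F V : Type*} [Field F] [AddCommGroup V] [Module F V] {σ : F →+* F}
    {B : V →ₛₗ[σ] V →ₗ[F] F} (hB : B.IsRefl) (N : Submodule F V) :
    (formRadical B N).submoduleOf N ≤ LinearMap.ker (B.domRestrict₁₂ N N) := by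
  intro x hx
  rw [LinearMap.mem_ker]
  ext y
  exact hB _ _ (hx.2 y y.2)

/-- The form induced by `B` on the quotient `N / (N ∩ N^⊥)`. -/
def quotientForm {F V : Type*} [Field F] [AddCommGroup V] [Module F V] {σ : F →+* F}
    (B : V →ₛₗ[σ] V →ₗ[F] F) (hB : B.IsRefl) (N : Submodule F V) :
    (↥N ⧸ (formRadical B N).submoduleOf N) →ₛₗ[σ]
      (↥N ⧸ (formRadical B N).submoduleOf N) →ₗ[F] F :=
  LinearMap.IsRefl.liftQ₂ (B.domRestrict₁₂ N N) ((formRadical B N).submoduleOf N)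
    (hB.domRestrict N) (formRadical_le_ker hB N)

theorem quotientForm_mk {F V : Type*} [Field F] [AddCommGroup V] [Module F V] {σ : F →+* F}
    (B : V →ₛₗ[σ] V →ₗ[F] F) (hB : B.IsRefl) (N : Submodule F V) (x y : ↥N) :
    quotientForm B hB N (Submodule.Quotient.mk x) (Submodule.Quotient.mk y) = B x y :=
  rfl

/-- The falling factorial `(n)_x = ∏_{i=1}^n (x^i - 1)`. -/
def qFalling (x : ℚ) (n : ℕ) : ℚ := ∏ i ∈ Finset.Icc 1 n, (x ^ i - 1)

/-- `e(r, χ) = q^{r/2} + ε^{r/2} χ` for `r` even and `e(r, χ) = 1` for `r` odd. -/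
def eFactor (q : ℕ) (ε : ℤ) (r : ℕ) (χ : ℤ) : ℚ :=
  if Even r then (q : ℚ) ^ (r / 2) + (ε : ℚ) ^ (r / 2) * χ else 1

/-- The explicit expression `Q(n, ψ₁, m, l, ψ₂)`, where `r = n + (2 / γ) m + l`, `χ = ψ₁ ε^m ψ₂`, `q₀ = #F₀`,
`q = #F` and `ε = sign (-1)`; it is `0` if `l` is negative. -/
def formulaQ (c : FormCase) (q₀ q : ℕ) (ε : ℤ) (r : ℕ) (χ : ℤ)
    (n : ℕ) (ψ₁ : ℤ) (m : ℕ) (l : ℤ) (ψ₂ : ℤ) : ℚ :=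
  if l < 0 then 0 else
    match c with
    | FormCase.hermitian =>
        (-1) ^ m * (-(q₀ : ℚ)) ^ (n * l.toNat) *
          (qFalling (-(q₀ : ℚ)) r /
            (qFalling (-(q₀ : ℚ)) n * qFalling ((q₀ : ℚ) ^ 2) m * qFalling (-(q₀ : ℚ)) l.toNat))
    | FormCase.symmetric =>
        (q : ℚ) ^ (n * l.toNat / 2) / 2 *
          (qFalling ((q : ℚ) ^ 2) (r / 2) /
            (qFalling ((q : ℚ) ^ 2) (n / 2) * qFalling (q : ℚ) m *
              qFalling ((q : ℚ) ^ 2) (l.toNat / 2))) *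
          (eFactor q ε n ψ₁ * eFactor q ε l.toNat ψ₂ / eFactor q ε r χ)
    | FormCase.alternating =>
        (q : ℚ) ^ (2 * n * l.toNat) *
          (qFalling ((q : ℚ) ^ 2) r /
            (qFalling ((q : ℚ) ^ 2) n * qFalling (q : ℚ) m * qFalling ((q : ℚ) ^ 2) l.toNat))

/-!
The subspaces `N` are counted by orbit–stabilizer without the group: one counts the frames adapted
to `N`, that is, pairs of a frame `e` with a fixed nondegenerate Gram matrix of sign `ψ₁` and an
isotropic `m`-frame in `e^⊥`, once as frames of `V` and once through the subspace they span. By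
Witt's theorem the number of frames with a given Gram matrix is the quotient `#O(V) / #O(e^⊥)` of
the orders of two isometry groups. Instead of invoking Witt's theorem one computes these numbers
with the explicit orders: splitting off vectors one at a time reduces everything to the number of
vectors of a given norm, and splitting `V` by an anisotropic vector gives a recursion for that
number in the dimension.
-/

/-! ### Families of vectors with a prescribed Gram matrix -/

section GramFrames

variable {F V : Type*} [Field F] [AddCommGroup V] [Module F V] {σ : F →+* F}
  {ι κ : Type*}

/-- The families of vectors with Gram matrix `G`. -/
def gramFrames (B : V →ₛₗ[σ] V →ₗ[F] F) (G : Matrix ι ι F) : Set (ι → V) :=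
  {e | ∀ i j, B (e i) (e j) = G i j}

/-- The subspace of the vectors orthogonal to all members of a family `e`. -/
def frameCompl (B : V →ₛₗ[σ] V →ₗ[F] F) (e : ι → V) : Submodule F V :=
  LinearMap.ker (LinearMap.pi fun i => B (e i))

/-- The restriction of a form to the orthogonal complement of a family `e`. -/
abbrev complForm (B : V →ₛₗ[σ] V →ₗ[F] F) (e : ι → V) :
    frameCompl B e →ₛₗ[σ] frameCompl B e →ₗ[F] F :=
  B.domRestrict₁₂ (frameCompl B e) (frameCompl B e)

variable {B : V →ₛₗ[σ] V →ₗ[F] F} {G : Matrix ι ι F} {e : ι → V}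

theorem mem_frameCompl {x : V} : x ∈ frameCompl B e ↔ ∀ i, B (e i) x = 0 := by
  simp [frameCompl, funext_iff]

theorem apply_eq_zero_of_mem_frameCompl (hB : B.IsRefl) {x : V} (hx : x ∈ frameCompl B e)
    (i : ι) : B x (e i) = 0 :=
  hB _ _ (mem_frameCompl.1 hx i)

theorem nondegenerate_of_separatingRight (hB : B.IsRefl) (h : B.SeparatingRight) :
    B.Nondegenerate :=
  ⟨fun y hy => h y fun x => hB _ _ (hy x), h⟩

/-- The families with block diagonal Gram matrix `diag(G, H)` are obtained by choosing a family with
Gram matrix `G` and then one with Gram matrix `H` in its orthogonal complement. -/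
def gramFramesSumEquiv (hB : B.IsRefl) (G : Matrix ι ι F) (H : Matrix κ κ F) :
    gramFrames B (Matrix.fromBlocks G 0 0 H) ≃
      Σ e : gramFrames B G, gramFrames (complForm B e.1) H where
  toFun f := ⟨⟨fun i => f.1 (Sum.inl i), fun i j => f.2 (Sum.inl i) (Sum.inl j)⟩,
    ⟨fun k => ⟨f.1 (Sum.inr k), mem_frameCompl.2 fun i => f.2 (Sum.inl i) (Sum.inr k)⟩,
      fun i j => f.2 (Sum.inr i) (Sum.inr j)⟩⟩
  invFun p := ⟨Sum.elim p.1.1 fun k => (p.2.1 k : V), by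
    rintro (i | i) (j | j)
    · exact p.1.2 i j
    · exact mem_frameCompl.1 (p.2.1 j).2 i
    · exact apply_eq_zero_of_mem_frameCompl hB (p.2.1 i).2 j
    · exact p.2.2 i j⟩
  left_inv f := by
    ext i
    rcases i with i | i <;> rfl
  right_inv p := rfl

theorem cast_card_sigma_of_card_eq {α : Type*} {β : α → Type*} [Finite α] [∀ a, Finite (β a)]
    {k : ℚ} (h : ∀ a, (Nat.card (β a) : ℚ) = k) :
    (Nat.card (Σ a, β a) : ℚ) = Nat.card α * k := by
  have := Fintype.ofFinite α
  rw [Nat.card_sigma, Nat.cast_sum, Finset.sum_congr rfl fun a _ => h a, Finset.sum_const,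
    nsmul_eq_mul, Finset.card_univ, Nat.card_eq_fintype_card]

variable [Fintype ι]

theorem apply_linearCombination (he : e ∈ gramFrames B G) (a : ι → F) (i : ι) :
    B (e i) (Fintype.linearCombination F e a) = G.mulVec a i := by
  simp [Fintype.linearCombination_apply, map_sum, Matrix.mulVec, dotProduct, he i, mul_comm]

theorem apply_linearCombination_of_mem_frameCompl (hB : B.IsRefl) {x : V}
    (hx : x ∈ frameCompl B e) (a : ι → F) : B (Fintype.linearCombination F e a) x = 0 := by
  refine hB _ _ ?_
  simp [Fintype.linearCombination_apply, map_sum, apply_eq_zero_of_mem_frameCompl hB hx]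

variable [DecidableEq ι]

theorem linearIndependent_of_mem_gramFrames (he : e ∈ gramFrames B G) (hG : G.det ≠ 0) :
    LinearIndependent F e := by
  rw [Fintype.linearIndependent_iff]
  intro a ha
  refine congrFun (Matrix.eq_zero_of_mulVec_eq_zero hG (funext fun i => ?_))
  rw [← apply_linearCombination he, Fintype.linearCombination_apply, ha, map_zero, Pi.zero_apply]

theorem nondegenerate_of_basis_mem_gramFrames (hB : B.IsRefl) {b : Module.Basis ι F V}
    (hb : ⇑b ∈ gramFrames B G) (hG : G.det ≠ 0) : B.Nondegenerate := by
  refine nondegenerate_of_separatingRight hB fun y hy => ?_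
  have hy' : Fintype.linearCombination F b (b.repr y) = y := b.sum_repr y
  have h0 : ⇑(b.repr y) = 0 := Matrix.eq_zero_of_mulVec_eq_zero hG (funext fun i => by
    rw [← apply_linearCombination hb, hy', hy, Pi.zero_apply])
  rw [← hy', h0, map_zero]

theorem det_ne_zero_of_basis_mem_gramFrames (hB : B.IsRefl) (hN : B.Nondegenerate)
    {b : Module.Basis ι F V} (hb : ⇑b ∈ gramFrames B G) : G.det ≠ 0 := by
  intro h0
  obtain ⟨a, ha, ha0⟩ := Matrix.exists_mulVec_eq_zero_iff.2 h0
  have hx : Fintype.linearCombination F b a = 0 := by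
    refine hN.1 _ fun y => ?_
    have hBx : B (Fintype.linearCombination F b a) = 0 :=
      b.ext fun i => hB _ _ (by rw [apply_linearCombination hb, ha0, Pi.zero_apply])
    rw [hBx, LinearMap.zero_apply]
  exact ha (funext (Fintype.linearIndependent_iff.1 b.linearIndependent a hx))

theorem bijective_coprod_subtype_frameCompl (he : e ∈ gramFrames B G) (hG : G.det ≠ 0) :
    Function.Bijective
      ((Fintype.linearCombination F e).coprod (frameCompl B e).subtype) := by
  constructor
  · rw [← LinearMap.ker_eq_bot, LinearMap.ker_eq_bot']
    rintro ⟨a, x⟩ hax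
    rw [LinearMap.coprod_apply, Submodule.subtype_apply] at hax
    have ha : a = 0 := Matrix.eq_zero_of_mulVec_eq_zero hG (funext fun i => by
      rw [← apply_linearCombination he, eq_neg_of_add_eq_zero_left hax, map_neg,
        mem_frameCompl.1 x.2, neg_zero, Pi.zero_apply])
    rw [ha, map_zero, zero_add] at hax
    exact Prod.ext ha (Subtype.ext hax)
  · intro v
    set a : ι → F := G⁻¹.mulVec fun i => B (e i) v with ha
    have hv : v - Fintype.linearCombination F e a ∈ frameCompl B e := mem_frameCompl.2 fun i => by
      rw [map_sub, apply_linearCombination he, ha, Matrix.mulVec_mulVec,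
        Matrix.mul_nonsing_inv _ hG.isUnit, Matrix.one_mulVec, sub_self]
    exact ⟨(a, ⟨_, hv⟩), by simp⟩

/-- The orthogonal decomposition of `V` into the span of a family with invertible Gram matrix,
in coordinates, and the orthogonal complement of that family. -/
noncomputable def splitEquiv (he : e ∈ gramFrames B G) (hG : G.det ≠ 0) :
    ((ι → F) × frameCompl B e) ≃ₗ[F] V :=
  LinearEquiv.ofBijective _ (bijective_coprod_subtype_frameCompl he hG)

theorem splitEquiv_apply (he : e ∈ gramFrames B G) (hG : G.det ≠ 0)
    (p : (ι → F) × frameCompl B e) :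
    splitEquiv he hG p = Fintype.linearCombination F e p.1 + p.2 := rfl

theorem card_add_finrank_frameCompl [FiniteDimensional F V] (he : e ∈ gramFrames B G)
    (hG : G.det ≠ 0) :
    Fintype.card ι + Module.finrank F (frameCompl B e) = Module.finrank F V := by
  rw [← (splitEquiv he hG).finrank_eq, Module.finrank_prod, Module.finrank_fintype_fun_eq_card]

theorem nondegenerate_complForm (hB : B.IsRefl) (hN : B.Nondegenerate)
    (he : e ∈ gramFrames B G) (hG : G.det ≠ 0) : (complForm B e).Nondegenerate := by
  refine nondegenerate_of_separatingRight (hB.domRestrict _) fun y hy =>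
    Subtype.ext (hN.2 _ fun x => ?_)
  obtain ⟨p, rfl⟩ := (splitEquiv he hG).surjective x
  rw [splitEquiv_apply, map_add, LinearMap.add_apply,
    apply_linearCombination_of_mem_frameCompl hB y.2, zero_add]
  exact hy p.2

/-- The basis of `V` which consists of a family with invertible Gram matrix and of a basis of its
orthogonal complement. -/
noncomputable def splitBasis (he : e ∈ gramFrames B G) (hG : G.det ≠ 0)
    (b : Module.Basis κ F (frameCompl B e)) : Module.Basis (ι ⊕ κ) F V :=
  ((Pi.basisFun F ι).prod b).map (splitEquiv he hG)

theorem splitBasis_mem_gramFrames (hB : B.IsRefl) (he : e ∈ gramFrames B G) (hG : G.det ≠ 0)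
    {b : Module.Basis κ F (frameCompl B e)} {H : Matrix κ κ F}
    (hb : ⇑b ∈ gramFrames (complForm B e) H) :
    ⇑(splitBasis he hG b) ∈ gramFrames B (Matrix.fromBlocks G 0 0 H) := by
  convert ((gramFramesSumEquiv hB G H).symm ⟨⟨e, he⟩, ⟨b, hb⟩⟩).2 using 1
  ext (i | k)
  all_goals simp [splitBasis, splitEquiv_apply, gramFramesSumEquiv, Equiv.symm]

end GramFrames

/-! ### Types of spaces -/

namespace FormCase

section Form

variable {F₀ F : Type*} [Field F₀] [Field F] [Algebra F₀ F]
  {V : Type*} [AddCommGroup V] [Module F V] {c : FormCase} {σ : F →+* F}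
  {B : V →ₛₗ[σ] V →ₗ[F] F}

theorem IsForm.restrict (hB : c.IsForm F₀ σ B) (W : Submodule F V) :
    c.IsForm F₀ σ (B.domRestrict₁₂ W W) := by
  cases c with
  | hermitian => exact ⟨hB.1, hB.2.1, hB.2.2.1, fun x y => hB.2.2.2 x y⟩
  | symmetric => exact ⟨hB.1, hB.2.1, hB.2.2.1, fun x y => hB.2.2.2 x y⟩
  | alternating => exact ⟨hB.1, hB.2.1, fun x => hB.2.2 x⟩

theorem IsForm.quotient (hB : c.IsForm F₀ σ B) (N : Submodule F V) :
    c.IsForm F₀ σ (quotientForm B hB.isRefl N) := by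
  cases c with
  | hermitian =>
    refine ⟨hB.1, hB.2.1, hB.2.2.1, fun x y => ?_⟩
    obtain ⟨x, rfl⟩ := Submodule.Quotient.mk_surjective _ x
    obtain ⟨y, rfl⟩ := Submodule.Quotient.mk_surjective _ y
    exact hB.2.2.2 x y
  | symmetric =>
    refine ⟨hB.1, hB.2.1, hB.2.2.1, fun x y => ?_⟩
    obtain ⟨x, rfl⟩ := Submodule.Quotient.mk_surjective _ x
    obtain ⟨y, rfl⟩ := Submodule.Quotient.mk_surjective _ y
    exact hB.2.2.2 x y
  | alternating =>
    refine ⟨hB.1, hB.2.1, fun x => ?_⟩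
    obtain ⟨x, rfl⟩ := Submodule.Quotient.mk_surjective _ x
    exact hB.2.2 x

end Form

theorem gamma_pos (c : FormCase) : 0 < c.gamma := by
  cases c <;> simp [gamma]

section Sign

variable {F : Type*} [Field F] [Fintype F] [DecidableEq F]

theorem sign_mul (c : FormCase) (a b : F) : c.sign F (a * b) = c.sign F a * c.sign F b := by
  cases c with
  | symmetric => exact map_mul (quadraticChar F) a b
  | _ => rfl

theorem sign_one (c : FormCase) : c.sign F 1 = 1 := by
  cases c <;> simp [sign]

theorem sign_mul_self (c : FormCase) {a : F} (ha : a ≠ 0) : c.sign F a * c.sign F a = 1 := by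
  cases c with
  | symmetric => rw [← sq]; exact quadraticChar_sq_one ha
  | _ => rfl

end Sign

section HasType

variable {F₀ F : Type*} [Field F₀] [Field F] [Algebra F₀ F] [Fintype F] [DecidableEq F]
  {V : Type*} [AddCommGroup V] [Module F V] {c : FormCase} {σ : F →+* F}
  {B : V →ₛₗ[σ] V →ₗ[F] F} {d : ℕ} {χ : ℤ}
  {ι : Type*} [Fintype ι] [DecidableEq ι] {G : Matrix ι ι F}

theorem HasType.finrank_eq (h : c.HasType B d χ) : Module.finrank F V = c.gamma * d := by
  obtain ⟨-, b, -⟩ := h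
  rw [Module.finrank_eq_card_basis b, Fintype.card_fin]

theorem sign_det_reindex {b : Module.Basis ι F V} {n : ℕ} (f : ι ≃ Fin n)
    (hb : ⇑b ∈ gramFrames B G) :
    c.sign F (Matrix.of fun i j => B (b.reindex f i) (b.reindex f j)).det = c.sign F G.det := by
  rw [← Matrix.det_submatrix_equiv_self f.symm G]
  congr 2
  ext i j
  simp [hb _ _]

theorem HasType.sign_det_eq (hB : c.IsForm F₀ σ B) (h : c.HasType B d χ)
    {b : Module.Basis ι F V} (hb : ⇑b ∈ gramFrames B G) : c.sign F G.det = χ := by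
  have hι := h.finrank_eq
  obtain ⟨-, b', rfl⟩ := h
  rw [Module.finrank_eq_card_basis b] at hι
  rw [← sign_det_reindex (Fintype.equivFinOfCardEq hι) hb, sign_det_gram_eq hB]

theorem hasType_of_basis_mem_gramFrames (hN : B.Nondegenerate) {b : Module.Basis ι F V}
    (hb : ⇑b ∈ gramFrames B G) (hι : Fintype.card ι = c.gamma * d) :
    c.HasType B d (c.sign F G.det) :=
  ⟨hN, b.reindex (Fintype.equivFinOfCardEq hι), sign_det_reindex _ hb⟩

theorem HasType.exists_sign_eq (hB : B.IsRefl) (h : c.HasType B d χ) :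
    ∃ a : F, a ≠ 0 ∧ c.sign F a = χ := by
  obtain ⟨hN, b, rfl⟩ := h
  exact ⟨_, det_ne_zero_of_basis_mem_gramFrames hB hN fun _ _ => rfl, rfl⟩

theorem HasType.mul_self_eq_one (hB : B.IsRefl) (h : c.HasType B d χ) : χ * χ = 1 := by
  obtain ⟨a, ha, rfl⟩ := h.exists_sign_eq hB
  exact sign_mul_self c ha

variable [FiniteDimensional F V] {e : ι → V}

theorem hasType_of_mem_gramFrames (hB : B.IsRefl) (he : e ∈ gramFrames B G) (hG : G.det ≠ 0)
    (hι : Fintype.card ι = c.gamma * d) (hV : Module.finrank F V = c.gamma * d) :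
    c.HasType B d (c.sign F G.det) := by
  have hli := linearIndependent_of_mem_gramFrames he hG
  have hb : ⇑(Module.Basis.mk hli (hli.span_eq_top_of_card_eq_finrank' (hι.trans hV.symm)).ge) ∈
      gramFrames B G := by
    rwa [Module.Basis.coe_mk]
  exact hasType_of_basis_mem_gramFrames (nondegenerate_of_basis_mem_gramFrames hB hb hG) hb hι

theorem hasType_complForm (hB : c.IsForm F₀ σ B) {n k : ℕ} (hV : c.HasType B (n + k) χ)
    (he : e ∈ gramFrames B G) (hG : G.det ≠ 0) (hι : Fintype.card ι = c.gamma * n) :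
    c.HasType (complForm B e) k (χ * c.sign F G.det) := by
  have hk : Module.finrank F (frameCompl B e) = c.gamma * k := by
    have := card_add_finrank_frameCompl he hG
    rw [hι, hV.finrank_eq, mul_add] at this
    exact Nat.add_left_cancel this
  let b := Module.finBasisOfFinrankEq F _ hk
  let H : Matrix _ _ F := Matrix.of fun i j => complForm B e (b i) (b j)
  have hb : ⇑b ∈ gramFrames (complForm B e) H := fun _ _ => rfl
  have hH := hasType_of_basis_mem_gramFrames (c := c) (nondegenerate_complForm hB.isRefl hV.1 he hG)
    hb (Fintype.card_fin _)
  have hχ := hV.sign_det_eq hB (splitBasis_mem_gramFrames hB.isRefl he hG hb)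
  rwa [← hχ, Matrix.det_fromBlocks_zero₂₁, sign_mul, mul_right_comm, sign_mul_self c hG, one_mul]

end HasType

end FormCase

/-! ### Isotropic frames -/

section IsoFrames

variable {F V : Type*} [Field F] [AddCommGroup V] [Module F V] {σ : F →+* F}

/-- The linearly independent families of pairwise orthogonal isotropic vectors. -/
def isoFrames (B : V →ₛₗ[σ] V →ₗ[F] F) (m : ℕ) : Set (Fin m → V) :=
  {u | LinearIndependent F u ∧ u ∈ gramFrames B (0 : Matrix (Fin m) (Fin m) F)}

/-- The nonzero isotropic vectors. -/
def isoVectors (B : V →ₛₗ[σ] V →ₗ[F] F) : Set V := {u | u ≠ 0 ∧ B u u = 0}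

/-- The Gram matrix of a pair of vectors. -/
def pairGram (B : V →ₛₗ[σ] V →ₗ[F] F) (u w : V) : Matrix (Fin 2) (Fin 2) F :=
  !![B u u, B u w; B w u, B w w]

variable {B : V →ₛₗ[σ] V →ₗ[F] F} {u w : V} {m : ℕ}

theorem pair_mem_gramFrames (u w : V) : ![u, w] ∈ gramFrames B (pairGram B u w) := by
  intro i j
  fin_cases i <;> fin_cases j <;> rfl

theorem det_pairGram (hu : B u u = 0) : (pairGram B u w).det = -(B u w * B w u) := by
  rw [pairGram, Matrix.det_fin_two_of, hu, zero_mul, zero_sub]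

theorem det_pairGram_ne_zero (hB : B.IsRefl) (hu : B u u = 0) (hw : B u w = 1) :
    (pairGram B u w).det ≠ 0 := by
  rw [det_pairGram hu, hw, one_mul, neg_ne_zero]
  exact fun h => one_ne_zero (hw.symm.trans (hB _ _ h))

theorem exists_apply_eq_one (hN : B.Nondegenerate) (hu : u ≠ 0) : ∃ w, B u w = 1 :=
  (LinearMap.surjective fun h => hu (hN.1 u fun y => by rw [h, LinearMap.zero_apply])) 1

variable (B u w) in
/-- The linear map which adds a multiple of `u` to a vector orthogonal to `u` and `w`. For a
hyperbolic pair `u, w` it identifies its domain with the hyperplane orthogonal to `u`. -/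
def addIsoVector : F × frameCompl B ![u, w] →ₗ[F] V :=
  (LinearMap.toSpanSingleton F V u).coprod (frameCompl B ![u, w]).subtype

theorem addIsoVector_apply (a : F) (x : frameCompl B ![u, w]) :
    addIsoVector B u w (a, x) = a • u + x := rfl

theorem apply_addIsoVector (hB : B.IsRefl) (hu : B u u = 0)
    (p q : F × frameCompl B ![u, w]) :
    B (addIsoVector B u w p) (addIsoVector B u w q) = B p.2 q.2 := by
  have huy (y : frameCompl B ![u, w]) : B u y = 0 := mem_frameCompl.1 y.2 0
  have hyu (y : frameCompl B ![u, w]) : B y u = 0 := hB _ _ (huy y)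
  obtain ⟨a, x⟩ := p
  obtain ⟨b, y⟩ := q
  simp [addIsoVector_apply, hu, huy, hyu]

theorem addIsoVector_eq_splitEquiv (hG : (pairGram B u w).det ≠ 0) (a : F)
    (x : frameCompl B ![u, w]) :
    addIsoVector B u w (a, x) = splitEquiv (pair_mem_gramFrames u w) hG (![a, 0], x) := by
  simp [addIsoVector_apply, splitEquiv_apply, Fintype.linearCombination_apply]

theorem addIsoVector_injective (hB : B.IsRefl) (hu : B u u = 0) (hw : B u w = 1) :
    Function.Injective (addIsoVector B u w) := by
  rintro ⟨a, x⟩ ⟨b, y⟩ h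
  have hG := det_pairGram_ne_zero hB hu hw
  rw [addIsoVector_eq_splitEquiv hG, addIsoVector_eq_splitEquiv hG] at h
  obtain ⟨hab, hxy⟩ := Prod.mk.inj ((splitEquiv _ hG).injective h)
  exact Prod.ext (congrFun hab 0) hxy

theorem exists_addIsoVector_eq (hB : B.IsRefl) (hu : B u u = 0) (hw : B u w = 1) {t : V}
    (ht : B u t = 0) : ∃ p, addIsoVector B u w p = t := by
  have hG := det_pairGram_ne_zero hB hu hw
  obtain ⟨⟨a, x⟩, rfl⟩ := (splitEquiv (pair_mem_gramFrames u w) hG).surjective t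
  have hux : B u x = 0 := mem_frameCompl.1 x.2 0
  have ha : a 1 = 0 := by
    simpa [splitEquiv_apply, Fintype.linearCombination_apply, hu, hw, hux] using ht
  refine ⟨(a 0, x), ?_⟩
  rw [addIsoVector_eq_splitEquiv hG]
  congr
  ext i
  fin_cases i <;> simp [ha]

theorem linearIndependent_cons_one_zero_iff {W : Type*} [AddCommGroup W] [Module F W]
    {p : Fin m → F × W} :
    LinearIndependent F (Fin.cons (1, 0) p : Fin (m + 1) → F × W) ↔
      LinearIndependent F (fun i => (p i).2) := by
  have hsum (g : Fin (m + 1) → F) :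
      ∑ i, g i • (Fin.cons (1, 0) p : Fin (m + 1) → F × W) i =
        (g 0 + ∑ i : Fin m, g i.succ * (p i).1, ∑ i : Fin m, g i.succ • (p i).2) := by
    rw [Fin.sum_univ_succ]
    ext <;> simp [Prod.fst_sum, Prod.snd_sum]
  simp only [Fintype.linearIndependent_iff, hsum, Prod.mk_eq_zero]
  constructor
  · intro h g hg i
    exact h (Fin.cons (-∑ i, g i * (p i).1) g) (by simpa using hg) i.succ
  · rintro h g ⟨hg0, hg⟩
    have hsucc := h (fun i => g i.succ) hg
    refine Fin.cases ?_ hsucc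
    simpa [hsucc] using hg0

theorem cons_addIsoVector_mem_isoFrames_iff (hB : B.IsRefl) (hu : B u u = 0) (hw : B u w = 1)
    {p : Fin m → F × frameCompl B ![u, w]} :
    (Fin.cons u fun i => addIsoVector B u w (p i) : Fin (m + 1) → V) ∈ isoFrames B (m + 1) ↔
      (fun i => (p i).2) ∈ isoFrames (complForm B ![u, w]) m := by
  have hcons : (Fin.cons u fun i => addIsoVector B u w (p i) : Fin (m + 1) → V) =
      addIsoVector B u w ∘ Fin.cons (1, 0) p := by
    ext i
    refine Fin.cases ?_ (fun i => ?_) i <;> simp [addIsoVector_apply]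
  rw [hcons]
  refine and_congr ?_ ?_
  · rw [(addIsoVector B u w).linearIndependent_iff
      (LinearMap.ker_eq_bot.2 (addIsoVector_injective hB hu hw)),
      linearIndependent_cons_one_zero_iff]
  · simp only [gramFrames, Set.mem_ofPred_eq, Function.comp_apply, apply_addIsoVector hB hu,
      Matrix.zero_apply]
    refine ⟨fun h i j => h i.succ j.succ, fun h i j => ?_⟩
    refine Fin.cases ?_ (fun i => ?_) i
    · simp
    · refine Fin.cases ?_ (fun j => ?_) j
      · simp
      · exact h i j

theorem card_cons_mem_isoFrames (hB : B.IsRefl) (hu : B u u = 0) (hw : B u w = 1) :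
    Nat.card {t : Fin m → V // (Fin.cons u t : Fin (m + 1) → V) ∈ isoFrames B (m + 1)} =
      Nat.card F ^ m * Nat.card (isoFrames (complForm B ![u, w]) m) := by
  rw [← Nat.card_fin m, ← Nat.card_fun, ← Nat.card_prod, Nat.card_fin]
  refine (Nat.card_congr (Equiv.ofBijective (fun p => ⟨fun i => addIsoVector B u w (p.1 i, p.2.1 i),
    (cons_addIsoVector_mem_isoFrames_iff hB hu hw).2 p.2.2⟩) ⟨?_, ?_⟩)).symm
  · rintro ⟨a, x⟩ ⟨b, y⟩ h
    have hi (i) : (a i, x.1 i) = (b i, y.1 i) :=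
      addIsoVector_injective hB hu hw (congrFun (congrArg Subtype.val h) i)
    exact Prod.ext (funext fun i => congrArg Prod.fst (hi i))
      (Subtype.ext (funext fun i => congrArg Prod.snd (hi i)))
  · rintro ⟨t, ht⟩
    have horth (i) : B u (t i) = 0 := ht.2 0 i.succ
    choose p hp using fun i => exists_addIsoVector_eq hB hu hw (horth i)
    obtain rfl : (fun i => addIsoVector B u w (p i)) = t := funext hp
    exact ⟨(fun i => (p i).1, ⟨_, (cons_addIsoVector_mem_isoFrames_iff hB hu hw).1 ht⟩), rfl⟩

/-- An isotropic family consists of its first vector and of the remaining ones. -/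
def isoFramesSuccEquiv (B : V →ₛₗ[σ] V →ₗ[F] F) (m : ℕ) : isoFrames B (m + 1) ≃
    Σ u : isoVectors B,
      {t : Fin m → V // (Fin.cons u.1 t : Fin (m + 1) → V) ∈ isoFrames B (m + 1)} where
  toFun f := ⟨⟨f.1 0, f.2.1.ne_zero 0, f.2.2 0 0⟩, ⟨Fin.tail f.1, by
    rw [Fin.cons_self_tail]; exact f.2⟩⟩
  invFun p := ⟨Fin.cons p.1.1 p.2.1, p.2.2⟩
  left_inv f := Subtype.ext (Fin.cons_self_tail f.1)
  right_inv p := rfl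

theorem card_isoFrames_succ [Finite V] (hB : B.IsRefl) (hN : B.Nondegenerate) {k : ℚ}
    (h : ∀ u w, B u u = 0 → B u w = 1 →
      (Nat.card (isoFrames (complForm B ![u, w]) m) : ℚ) = k) :
    (Nat.card (isoFrames B (m + 1)) : ℚ) = Nat.card (isoVectors B) * (Nat.card F ^ m * k) := by
  rw [Nat.card_congr (isoFramesSuccEquiv B m)]
  refine cast_card_sigma_of_card_eq fun u => ?_
  obtain ⟨w, hw⟩ := exists_apply_eq_one hN u.2.1
  rw [card_cons_mem_isoFrames hB u.2.2 hw, Nat.cast_mul, h _ _ u.2.2 hw, Nat.cast_pow]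

theorem card_isoFrames_zero : Nat.card (isoFrames B 0) = 1 := by
  have : Unique (isoFrames B 0) := ⟨⟨⟨Fin.elim0, linearIndependent_empty_type, fun i => i.elim0⟩⟩,
    fun x => Subtype.ext (Subsingleton.elim _ _)⟩
  exact Nat.card_unique

end IsoFrames

/-! ### Counting frames adapted to a subspace -/

section QFalling

theorem qFalling_zero (x : ℚ) : qFalling x 0 = 1 := by simp [qFalling]

theorem qFalling_succ (x : ℚ) (n : ℕ) : qFalling x (n + 1) = qFalling x n * (x ^ (n + 1) - 1) := by
  rw [qFalling, qFalling, Finset.prod_Icc_succ_top (by omega)]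

theorem qFalling_ne_zero {x : ℚ} (hx : 1 < |x|) (n : ℕ) : qFalling x n ≠ 0 := by
  rw [qFalling, Finset.prod_ne_zero_iff]
  intro i hi h
  have h1 : |x| ^ i = 1 := by rw [← abs_pow, sub_eq_zero.1 h, abs_one]
  exact (one_lt_pow₀ hx (by have := Finset.mem_Icc.1 hi; omega)).ne' h1

/-- The order of the general linear group `GL_m` over a field with `x` elements. -/
def glOrder (x : ℚ) (m : ℕ) : ℚ := x ^ m.choose 2 * qFalling x m

theorem glOrder_ne_zero {x : ℚ} (hx : 1 < x) (m : ℕ) : glOrder x m ≠ 0 :=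
  mul_ne_zero (pow_ne_zero _ (zero_lt_one.trans hx).ne')
    (qFalling_ne_zero (hx.trans_le (le_abs_self x)) m)

theorem prod_pow_sub_pow_eq_glOrder (x : ℚ) (m : ℕ) :
    ∏ i : Fin m, (x ^ m - x ^ (i : ℕ)) = glOrder x m := by
  rw [← Finset.prod_range fun i => x ^ m - x ^ i]
  induction m with
  | zero => simp [glOrder, qFalling]
  | succ m ih =>
    rw [glOrder] at ih ⊢
    rw [Finset.prod_range_succ', qFalling_succ, Nat.choose_succ_succ' m 1, Nat.choose_one_right]
    simp only [pow_succ' x, pow_zero, ← mul_sub, Finset.prod_mul_distrib, Finset.prod_const,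
      Finset.card_range, ih]
    ring

theorem card_linearIndependent_eq_glOrder {F W : Type*} [Field F] [Fintype F] [AddCommGroup W]
    [Module F W] [Finite W] {m : ℕ} (hW : Module.finrank F W = m) :
    (Nat.card {u : Fin m → W // LinearIndependent F u} : ℚ) = glOrder (Fintype.card F) m := by
  rw [card_linearIndependent hW.ge, hW, ← prod_pow_sub_pow_eq_glOrder, Nat.cast_prod]
  refine Finset.prod_congr rfl fun i _ => ?_
  rw [Nat.cast_sub (Nat.pow_le_pow_right Fintype.card_pos i.2.le), Nat.cast_pow, Nat.cast_pow]

end QFalling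

section MixedFrames

variable {F V : Type*} [Field F] [AddCommGroup V] [Module F V] {σ : F →+* F}
  {B : V →ₛₗ[σ] V →ₗ[F] F} {κ : Type*} {G : Matrix κ κ F} {m : ℕ}

/-- The pairs of a family with Gram matrix `G` and an isotropic family orthogonal to it. They are
bases of the subspaces whose radical is spanned by the second family. -/
abbrev MixedFrames (B : V →ₛₗ[σ] V →ₗ[F] F) (G : Matrix κ κ F) (m : ℕ) : Type _ :=
  Σ e : gramFrames B G, isoFrames (complForm B e.1) m

namespace MixedFrames

/-- The span of the isotropic part of a mixed family. -/
def isoSpan (t : MixedFrames B G m) : Submodule F V :=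
  Submodule.span F (Set.range fun i => (t.2.1 i : V))

/-- The span of a mixed family. -/
def span (t : MixedFrames B G m) : Submodule F V :=
  Submodule.span F (Set.range t.1.1) ⊔ t.isoSpan

variable (t : MixedFrames B G m)

theorem iso_mem_isoSpan (i : Fin m) : (t.2.1 i : V) ∈ t.isoSpan :=
  Submodule.subset_span ⟨i, rfl⟩

theorem gram_mem_span (i : κ) : t.1.1 i ∈ t.span :=
  Submodule.mem_sup_left (Submodule.subset_span ⟨i, rfl⟩)

theorem span_le_iff {N : Submodule F V} :
    t.span ≤ N ↔ (∀ i, t.1.1 i ∈ N) ∧ ∀ j, (t.2.1 j : V) ∈ N := by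
  simp [span, isoSpan, Submodule.span_le, Set.range_subset_iff]

theorem isoSpan_le_frameCompl : t.isoSpan ≤ frameCompl B t.1.1 := by
  rw [isoSpan, Submodule.span_le]
  rintro _ ⟨i, rfl⟩
  exact (t.2.1 i).2

theorem linearIndependent_iso : LinearIndependent F fun i => (t.2.1 i : V) :=
  t.2.2.1.map' _ (Submodule.ker_subtype _)

theorem finrank_isoSpan : Module.finrank F t.isoSpan = m := by
  rw [isoSpan, finrank_span_eq_card t.linearIndependent_iso, Fintype.card_fin]

theorem isoSpan_le_formRadical_span (hB : B.IsRefl) : t.isoSpan ≤ formRadical B t.span := by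
  rw [isoSpan, Submodule.span_le]
  rintro _ ⟨j, rfl⟩
  have hker : t.span ≤ LinearMap.ker (B (t.2.1 j)) :=
    t.span_le_iff.2 ⟨apply_eq_zero_of_mem_frameCompl hB (t.2.1 j).2, t.2.2.2 j⟩
  exact ⟨Submodule.mem_sup_right (t.iso_mem_isoSpan j), fun x hx => hB _ _ (hker hx)⟩

variable [Fintype κ] [DecidableEq κ]

theorem disjoint_span_gram_frameCompl (hG : G.det ≠ 0) :
    Disjoint (Submodule.span F (Set.range t.1.1)) (frameCompl B t.1.1) := by
  rw [Submodule.disjoint_def, ← Fintype.range_linearCombination]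
  rintro _ ⟨a, rfl⟩ ha
  rw [Matrix.eq_zero_of_mulVec_eq_zero hG (v := a), map_zero]
  ext i
  rw [← apply_linearCombination t.1.2, mem_frameCompl.1 ha i, Pi.zero_apply]

theorem formRadical_span (hB : B.IsRefl) (hG : G.det ≠ 0) :
    formRadical B t.span = t.isoSpan := by
  refine le_antisymm ?_ (t.isoSpan_le_formRadical_span hB)
  rintro x ⟨hx, hx'⟩
  obtain ⟨y, hy, z, hz, rfl⟩ := Submodule.mem_sup.1 hx
  have hyc : y ∈ frameCompl B t.1.1 := by
    rw [← Submodule.add_mem_iff_left _ (t.isoSpan_le_frameCompl hz)]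
    exact mem_frameCompl.2 fun i => hx' _ (t.gram_mem_span i)
  rwa [Submodule.disjoint_def.1 (t.disjoint_span_gram_frameCompl hG) y hy hyc, zero_add]

theorem finrank_formRadical_span (hB : B.IsRefl) (hG : G.det ≠ 0) :
    Module.finrank F (formRadical B t.span) = m := by
  rw [t.formRadical_span hB hG, t.finrank_isoSpan]

theorem finrank_span [FiniteDimensional F V] (hG : G.det ≠ 0) :
    Module.finrank F t.span = Fintype.card κ + m := by
  have hdisj := (t.disjoint_span_gram_frameCompl hG).mono_right t.isoSpan_le_frameCompl
  have h := Submodule.finrank_sup_add_finrank_inf_eq (Submodule.span F (Set.range t.1.1)) t.isoSpan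
  rwa [hdisj.eq_bot, finrank_bot, add_zero, finrank_isoSpan,
    finrank_span_eq_card (linearIndependent_of_mem_gramFrames t.1.2 hG)] at h

variable {N : Submodule F V}

/-- The mixed family formed by a family in `N` with Gram matrix `G` and by linearly independent
vectors of the radical of `N`. -/
def ofFormRadical (e : gramFrames (B.domRestrict₁₂ N N) G)
    (u : {u : Fin m → formRadical B N // LinearIndependent F u}) : MixedFrames B G m :=
  ⟨⟨fun i => e.1 i, e.2⟩, fun j => ⟨u.1 j, mem_frameCompl.2 fun i => (u.1 j).2.2 _ (e.1 i).2⟩,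
    LinearIndependent.of_comp (frameCompl B _).subtype
      (u.2.map' (formRadical B N).subtype (Submodule.ker_subtype _)),
    fun i j => (u.1 j).2.2 _ (u.1 i).2.1⟩

theorem span_ofFormRadical [FiniteDimensional F V] (hG : G.det ≠ 0)
    (hN : Module.finrank F N = Fintype.card κ + m) (e : gramFrames (B.domRestrict₁₂ N N) G)
    (u : {u : Fin m → formRadical B N // LinearIndependent F u}) :
    (ofFormRadical e u).span = N :=
  Submodule.eq_of_le_of_finrank_eq
    ((span_le_iff _).2 ⟨fun i => (e.1 i).2, fun j => (u.1 j).2.1⟩)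
    ((finrank_span _ hG).trans hN.symm)

/-- The mixed families spanning a given subspace `N`. -/
def spanEqEquiv [FiniteDimensional F V] (hB : B.IsRefl) (hG : G.det ≠ 0)
    (hN : Module.finrank F N = Fintype.card κ + m) :
    {t : MixedFrames B G m // t.span = N} ≃
      gramFrames (B.domRestrict₁₂ N N) G ×
        {u : Fin m → formRadical B N // LinearIndependent F u} where
  toFun t := (⟨fun i => ⟨t.1.1.1 i, t.2.le (t.1.gram_mem_span i)⟩, t.1.1.2⟩,
    ⟨fun j => ⟨t.1.2.1 j, (congrArg (formRadical B) t.2).le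
      (t.1.isoSpan_le_formRadical_span hB (t.1.iso_mem_isoSpan j))⟩,
      LinearIndependent.of_comp (formRadical B N).subtype t.1.linearIndependent_iso⟩)
  invFun p := ⟨ofFormRadical p.1 p.2, span_ofFormRadical hG hN p.1 p.2⟩
  left_inv _ := rfl
  right_inv _ := rfl

end MixedFrames

end MixedFrames

section Quotient

variable {F V : Type*} [Field F] [AddCommGroup V] [Module F V] {σ : F →+* F}
  {B : V →ₛₗ[σ] V →ₗ[F] F} {κ : Type*}

theorem card_gramFrames_of_surjective [Finite κ] {W : Type*} [AddCommGroup W] [Module F W]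
    {B' : W →ₛₗ[σ] W →ₗ[F] F} {f : V →ₗ[F] W} (hf : Function.Surjective f)
    (hB : ∀ x y, B' (f x) (f y) = B x y) (G : Matrix κ κ F) :
    Nat.card (gramFrames B G) =
      Nat.card (gramFrames B' G) * Nat.card (LinearMap.ker f) ^ Nat.card κ := by
  obtain ⟨g, hg⟩ := f.exists_rightInverse_of_surjective (LinearMap.range_eq_top.2 hf)
  have hfg (w : W) : f (g w) = w := LinearMap.congr_fun hg w
  rw [← Nat.card_fun, ← Nat.card_prod]
  exact Nat.card_congr
    { toFun := fun e => (⟨fun i => f (e.1 i), fun i j => (hB _ _).trans (e.2 i j)⟩,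
        fun i => ⟨e.1 i - g (f (e.1 i)), by simp [hfg]⟩)
      invFun := fun p => ⟨fun i => g (p.1.1 i) + p.2 i, fun i j => by
        rw [← hB]
        simpa [hfg] using p.1.2 i j⟩
      left_inv := fun e => by ext; simp
      right_inv := fun p => by ext <;> simp [hfg] }

theorem finrank_formRadical_submoduleOf (N : Submodule F V) :
    Module.finrank F ((formRadical B N).submoduleOf N) = Module.finrank F (formRadical B N) :=
  (Submodule.submoduleOfEquivOfLe inf_le_left).finrank_eq

theorem finrank_quotient_add_finrank_formRadical [FiniteDimensional F V] (N : Submodule F V) :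
    Module.finrank F (↥N ⧸ (formRadical B N).submoduleOf N) +
      Module.finrank F (formRadical B N) = Module.finrank F N := by
  rw [← Submodule.finrank_quotient_add_finrank ((formRadical B N).submoduleOf N),
    finrank_formRadical_submoduleOf]

theorem card_gramFrames_domRestrict [Fintype κ] [Finite V] [Fintype F] (hB : B.IsRefl)
    (N : Submodule F V) (G : Matrix κ κ F) :
    Nat.card (gramFrames (B.domRestrict₁₂ N N) G) = Nat.card (gramFrames (quotientForm B hB N) G) *
      Fintype.card F ^ (Module.finrank F (formRadical B N) * Fintype.card κ) := by
  rw [card_gramFrames_of_surjective (Submodule.mkQ_surjective ((formRadical B N).submoduleOf N))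
    (quotientForm_mk B hB N), Submodule.ker_mkQ,
    Module.natCard_eq_pow_finrank (K := F) (V := (formRadical B N).submoduleOf N),
    finrank_formRadical_submoduleOf, Nat.card_eq_fintype_card (α := F),
    Nat.card_eq_fintype_card (α := κ), ← pow_mul]

theorem isRefl_quotientForm (hB : B.IsRefl) (N : Submodule F V) :
    (quotientForm B hB N).IsRefl := by
  intro x y
  obtain ⟨x, rfl⟩ := Submodule.Quotient.mk_surjective _ x
  obtain ⟨y, rfl⟩ := Submodule.Quotient.mk_surjective _ y
  exact hB x y

end Quotient

namespace FormCase

variable {F V : Type*} [Field F] [AddCommGroup V] [Module F V] {σ : F →+* F}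
  {B : V →ₛₗ[σ] V →ₗ[F] F} {κ : Type*} {G : Matrix κ κ F} {m n : ℕ}
  {c : FormCase} [Fintype F] [DecidableEq F] [Finite V] [Fintype κ] [DecidableEq κ]

/-- The subspaces with radical of dimension `m` and nondegenerate quotient of type `(n, ψ)`. -/
abbrev TypedSubspaces (c : FormCase) (B : V →ₛₗ[σ] V →ₗ[F] F) (hB : B.IsRefl)
    (m n : ℕ) (ψ : ℤ) : Type _ :=
  {N : Submodule F V // Module.finrank F (formRadical B N) = m ∧
    c.HasType (quotientForm B hB N) n ψ}

theorem hasType_quotientForm_span (hB : B.IsRefl) (hG : G.det ≠ 0)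
    (hκ : Fintype.card κ = c.gamma * n) (t : MixedFrames B G m) :
    c.HasType (quotientForm B hB t.span) n (c.sign F G.det) := by
  have hdim := finrank_quotient_add_finrank_formRadical (B := B) t.span
  rw [t.finrank_formRadical_span hB hG, t.finrank_span hG, hκ] at hdim
  exact hasType_of_mem_gramFrames (isRefl_quotientForm hB _)
    (e := fun i => Submodule.Quotient.mk ⟨t.1.1 i, t.gram_mem_span i⟩)
    (fun i j => (quotientForm_mk B hB t.span _ _).trans (t.1.2 i j)) hG hκ
    (Nat.add_right_cancel hdim)

theorem card_mixedFrames_span_eq (hB : B.IsRefl) (hG : G.det ≠ 0) {ψ : ℤ}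
    (hκ : Fintype.card κ = c.gamma * n) {N : Submodule F V}
    (hm : Module.finrank F (formRadical B N) = m) (hN : c.HasType (quotientForm B hB N) n ψ) :
    (Nat.card {t : MixedFrames B G m // t.span = N} : ℚ) =
      Nat.card (gramFrames (quotientForm B hB N) G) *
        (Fintype.card F : ℚ) ^ (m * (c.gamma * n)) * glOrder (Fintype.card F) m := by
  have hdim : Module.finrank F N = Fintype.card κ + m := by
    rw [← finrank_quotient_add_finrank_formRadical (B := B) N, hm, hN.finrank_eq, hκ]
  rw [Nat.card_congr (MixedFrames.spanEqEquiv hB hG hdim), Nat.card_prod, Nat.cast_mul,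
    card_linearIndependent_eq_glOrder hm, card_gramFrames_domRestrict hB, hm, hκ]
  push_cast
  rfl

theorem card_mixedFrames (hB : B.IsRefl) (hG : G.det ≠ 0) {k : ℚ}
    (hκ : Fintype.card κ = c.gamma * n)
    (hk : ∀ N : TypedSubspaces c B hB m n (c.sign F G.det),
      (Nat.card (gramFrames (quotientForm B hB N.1) G) : ℚ) = k) :
    (Nat.card (MixedFrames B G m) : ℚ) = Nat.card (TypedSubspaces c B hB m n (c.sign F G.det)) *
      (k * (Fintype.card F : ℚ) ^ (m * (c.gamma * n)) * glOrder (Fintype.card F) m) := by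
  let span (t : MixedFrames B G m) : TypedSubspaces c B hB m n (c.sign F G.det) :=
    ⟨t.span, t.finrank_formRadical_span hB hG, hasType_quotientForm_span hB hG hκ t⟩
  rw [← Nat.card_congr (Equiv.sigmaFiberEquiv span)]
  refine cast_card_sigma_of_card_eq fun N => ?_
  rw [← hk N, ← card_mixedFrames_span_eq hB hG hκ N.2.1 N.2.2]
  exact congrArg Nat.cast (Nat.card_congr (Equiv.subtypeEquivRight fun t => Subtype.ext_iff))

end FormCase

/-! ### Sums over a finite field -/

section ScalarSums

/-- The function `Q • 1₀ - 1`, where `1₀` is the indicator function of `0`. For `Q = #F` it has mean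
zero on `F`, and the vector counts deviate from their mean by a multiple of it. -/
def centeredDelta {F : Type*} [Zero F] [DecidableEq F] (Q : ℤ) (y : F) : ℤ :=
  Q * (if y = 0 then 1 else 0) - 1

variable {F : Type*} [Field F] [Fintype F] [DecidableEq F]

theorem sum_centeredDelta_sub (a : F) : ∑ y : F, centeredDelta (Fintype.card F) (a - y) = 0 := by
  simp [centeredDelta, sub_eq_zero, Finset.sum_sub_distrib]

theorem sum_quadraticChar_sub (hF : ringChar F ≠ 2) (a : F) :
    ∑ y : F, quadraticChar F (a - y) = 0 := by
  rw [← quadraticChar_sum_zero hF]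
  exact Fintype.sum_equiv (Equiv.subLeft a) _ _ fun y => rfl

theorem sum_quadraticChar_mul_neg :
    ∑ y : F, quadraticChar F y * quadraticChar F (-y) =
      quadraticChar F (-1) * (Fintype.card F - 1) := by
  have hterm (y : F) : quadraticChar F y * quadraticChar F (-y) =
      quadraticChar F (-1) * if y = 0 then 0 else 1 := by
    rw [← neg_one_mul y, map_mul, mul_left_comm, ← sq]
    split_ifs with hy
    · rw [hy, MulChar.map_zero, zero_pow two_ne_zero, mul_zero]
    · rw [quadraticChar_sq_one hy]
  rw [Finset.sum_congr rfl fun y _ => hterm y, ← Finset.mul_sum, Finset.sum_ite,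
    Finset.sum_const_zero, zero_add, Finset.sum_const, Finset.filter_ne',
    Finset.card_erase_of_mem (Finset.mem_univ _), Finset.card_univ, nsmul_one,
    Nat.cast_pred Fintype.card_pos]

theorem sum_quadraticChar_mul_sub_of_ne_zero (hF : ringChar F ≠ 2) {a : F} (ha : a ≠ 0) :
    ∑ y : F, quadraticChar F y * quadraticChar F (a - y) = -quadraticChar F (-1) := by
  have hscale : ∑ y : F, quadraticChar F y * quadraticChar F (a - y) =
      ∑ t : F, quadraticChar F t * quadraticChar F (1 - t) := by
    refine (Fintype.sum_equiv (Equiv.mulLeft₀ a ha) _ _ fun t => ?_).symm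
    rw [Equiv.mulLeft₀_apply, show a - a * t = a * (1 - t) by ring, map_mul, map_mul]
    linear_combination (-(quadraticChar F t * quadraticChar F (1 - t))) * quadraticChar_sq_one ha
  rw [hscale, ← jacobiSum_nontrivial_inv (quadraticChar_ne_one hF),
    (quadraticChar_isQuadratic F).inv]
  rfl

theorem sum_quadraticChar_mul_sub (hF : ringChar F ≠ 2) (a : F) :
    ∑ y : F, quadraticChar F y * quadraticChar F (a - y) =
      quadraticChar F (-1) * centeredDelta (Fintype.card F) a := by
  rcases eq_or_ne a 0 with rfl | ha
  · simpa [centeredDelta] using sum_quadraticChar_mul_neg (F := F)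
  · simpa [centeredDelta, ha] using sum_quadraticChar_mul_sub_of_ne_zero hF ha

theorem sum_comp_mul_mul_self (hF : ringChar F ≠ 2) {d : F} (hd : d ≠ 0) (f : F → ℤ) :
    ∑ x : F, f (x * d * x) = ∑ y : F, f y * (1 + quadraticChar F (d * y)) := by
  have hexpand (x : F) : f (x * d * x) = ∑ t : F, if x ^ 2 = t then f (d * t) else 0 := by
    rw [Finset.sum_ite_eq, if_pos (Finset.mem_univ _)]
    congr 1
    ring
  have hsqrts (t : F) : (∑ x : F, if x ^ 2 = t then f (d * t) else 0) =
      f (d * t) * (1 + quadraticChar F t) := by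
    rw [← Finset.sum_filter, Finset.sum_const, nsmul_eq_mul, mul_comm, add_comm,
      ← quadraticChar_card_sqrts hF t]
    congr 3
    ext
    simp
  rw [Finset.sum_congr rfl fun x _ => hexpand x, Finset.sum_comm,
    Finset.sum_congr rfl fun t _ => hsqrts t]
  refine Fintype.sum_equiv (Equiv.mulLeft₀ d hd) _ _ fun t => ?_
  rw [Equiv.mulLeft₀_apply, ← mul_assoc, map_mul, ← sq, quadraticChar_sq_one' hd, one_mul]

theorem sum_centeredDelta_sub_mul_mul_self (hF : ringChar F ≠ 2) {d : F} (hd : d ≠ 0) (a : F) :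
    ∑ x : F, centeredDelta (Fintype.card F) (a - x * d * x) =
      Fintype.card F * (quadraticChar F d * quadraticChar F a) := by
  rw [sum_comp_mul_mul_self hF hd fun y => centeredDelta (Fintype.card F) (a - y)]
  simp only [mul_add, mul_one, Finset.sum_add_distrib, sum_centeredDelta_sub, map_mul, zero_add]
  simp only [centeredDelta, sub_mul, one_mul, Finset.sum_sub_distrib, ← Finset.mul_sum,
    quadraticChar_sum_zero hF, mul_zero, sub_zero, sub_eq_zero, mul_assoc]
  simp

theorem sum_quadraticChar_sub_mul_mul_self (hF : ringChar F ≠ 2) {d : F} (hd : d ≠ 0) (a : F) :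
    ∑ x : F, quadraticChar F (a - x * d * x) =
      quadraticChar F d * (quadraticChar F (-1) * centeredDelta (Fintype.card F) a) := by
  rw [sum_comp_mul_mul_self hF hd fun y => quadraticChar F (a - y),
    ← sum_quadraticChar_mul_sub hF, Finset.mul_sum]
  simp only [mul_add, mul_one, Finset.sum_add_distrib, sum_quadraticChar_sub hF, map_mul, zero_add]
  exact Finset.sum_congr rfl fun y _ => by ring

end ScalarSums

section QuadraticExtension

variable {F₀ F : Type*} [Field F₀] [Field F] [Algebra F₀ F] {σ : F →+* F}

section Conjugation

variable [Finite F]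

/-- A ring endomorphism `σ` of a finite field that fixes the base field, as an algebra
automorphism. -/
noncomputable def algEquivOfFixes (σ : F →+* F)
    (hσ : ∀ a : F₀, σ (algebraMap F₀ F a) = algebraMap F₀ F a) : F ≃ₐ[F₀] F :=
  AlgEquiv.ofBijective (⟨σ, hσ⟩ : F →ₐ[F₀] F) (Finite.injective_iff_bijective.1 σ.injective)

theorem one_ne_algEquivOfFixes (hσ : ∀ a : F₀, σ (algebraMap F₀ F a) = algebraMap F₀ F a)
    (hσ1 : σ ≠ RingHom.id F) : 1 ≠ algEquivOfFixes σ hσ :=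
  fun h => hσ1 (RingHom.ext fun x => (AlgEquiv.congr_fun h x).symm)

theorem univ_algEquiv_eq_pair (h2 : Module.finrank F₀ F = 2)
    (hσ : ∀ a : F₀, σ (algebraMap F₀ F a) = algebraMap F₀ F a) (hσ1 : σ ≠ RingHom.id F)
    [Fintype (F ≃ₐ[F₀] F)] [DecidableEq (F ≃ₐ[F₀] F)] :
    (Finset.univ : Finset (F ≃ₐ[F₀] F)) = {1, algEquivOfFixes σ hσ} := by
  refine (Finset.eq_univ_of_card _ ?_).symm
  rw [Finset.card_pair (one_ne_algEquivOfFixes hσ hσ1), ← h2, ← Nat.card_eq_fintype_card,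
    IsGalois.card_aut_eq_finrank]

theorem algebraMap_norm_eq_mul (h2 : Module.finrank F₀ F = 2)
    (hσ : ∀ a : F₀, σ (algebraMap F₀ F a) = algebraMap F₀ F a) (hσ1 : σ ≠ RingHom.id F) (x : F) :
    algebraMap F₀ F (Algebra.norm F₀ x) = σ x * x := by
  classical
  rw [Algebra.norm_eq_prod_automorphisms, univ_algEquiv_eq_pair h2 hσ hσ1,
    Finset.prod_pair (one_ne_algEquivOfFixes hσ hσ1), mul_comm]
  rfl

theorem exists_algebraMap_eq_of_fixed (h2 : Module.finrank F₀ F = 2)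
    (hσ : ∀ a : F₀, σ (algebraMap F₀ F a) = algebraMap F₀ F a) (hσ1 : σ ≠ RingHom.id F) {x : F}
    (hx : σ x = x) : ∃ a : F₀, algebraMap F₀ F a = x := by
  classical
  refine (IsGalois.mem_range_algebraMap_iff_fixed x).2 fun f => ?_
  have hf := Finset.mem_univ f
  rw [univ_algEquiv_eq_pair h2 hσ hσ1, Finset.mem_insert, Finset.mem_singleton] at hf
  rcases hf with rfl | rfl
  · rfl
  · exact hx

end Conjugation

variable [Fintype F]

theorem card_eq_sq_of_finrank_eq_two [Fintype F₀] (h2 : Module.finrank F₀ F = 2) :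
    Fintype.card F = Fintype.card F₀ ^ 2 := by
  rw [← h2, ← Module.card_eq_pow_finrank]

variable [DecidableEq F₀]

theorem card_filter_norm_eq_zero :
    (Finset.univ.filter fun x : F => Algebra.norm F₀ x = 0).card = 1 := by
  rw [Finset.card_eq_one]
  exact ⟨0, by ext x; simp⟩

theorem card_filter_norm_eq_of_ne_zero {t : F₀} (ht : t ≠ 0) :
    (Finset.univ.filter fun x : F => Algebra.norm F₀ x = t).card =
      (Finset.univ.filter fun x : F => Algebra.norm F₀ x = 1).card := by
  obtain ⟨y, rfl⟩ := FiniteField.norm_surjective F₀ F t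
  have hy : y ≠ 0 := by
    rintro rfl
    exact ht Algebra.norm_zero
  refine (Finset.card_equiv (Equiv.mulRight₀ y hy) fun x => ?_).symm
  simp [ht]

variable [Fintype F₀]

theorem card_filter_norm_eq (h2 : Module.finrank F₀ F = 2) {t : F₀} (ht : t ≠ 0) :
    (Finset.univ.filter fun x : F => Algebra.norm F₀ x = t).card = Fintype.card F₀ + 1 := by
  have hsum := Finset.card_eq_sum_card_fiberwise (f := fun x : F => Algebra.norm F₀ x)
    (s := Finset.univ) (t := Finset.univ) fun _ _ => Finset.mem_coe.2 (Finset.mem_univ _)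
  rw [← Finset.add_sum_erase _ _ (Finset.mem_univ (0 : F₀)), card_filter_norm_eq_zero,
    Finset.sum_congr rfl fun t ht =>
      card_filter_norm_eq_of_ne_zero (F := F) (Finset.ne_of_mem_erase ht),
    Finset.sum_const, Finset.card_erase_of_mem (Finset.mem_univ _), Finset.card_univ,
    Finset.card_univ, card_eq_sq_of_finrank_eq_two h2, smul_eq_mul] at hsum
  rw [card_filter_norm_eq_of_ne_zero ht]
  obtain ⟨s, hs⟩ : ∃ s, Fintype.card F₀ = s + 2 :=
    ⟨_, (Nat.sub_add_cancel Fintype.one_lt_card).symm⟩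
  rw [hs, show s + 2 - 1 = s + 1 by omega] at hsum
  rw [hs]
  refine Nat.eq_of_mul_eq_mul_left s.succ_pos ?_
  linarith

theorem sum_centeredDelta_norm (h2 : Module.finrank F₀ F = 2) {d : F₀} (hd : d ≠ 0) (a : F₀) :
    ∑ x : F, centeredDelta (Fintype.card F₀) (a - d * Algebra.norm F₀ x) =
      -Fintype.card F₀ * centeredDelta (Fintype.card F₀) a := by
  have hfiber (x : F) : a - d * Algebra.norm F₀ x = 0 ↔ Algebra.norm F₀ x = d⁻¹ * a := by
    rw [sub_eq_zero, eq_inv_mul_iff_mul_eq₀ hd, eq_comm]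
  simp only [centeredDelta, hfiber, Finset.sum_sub_distrib, ← Finset.mul_sum, Finset.sum_boole,
    Finset.sum_const, Finset.card_univ, card_eq_sq_of_finrank_eq_two h2]
  rcases eq_or_ne a 0 with rfl | ha
  · rw [mul_zero, card_filter_norm_eq_zero, if_pos rfl, nsmul_one]
    push_cast
    ring
  · rw [card_filter_norm_eq h2 (mul_ne_zero (inv_ne_zero hd) ha), if_neg ha, nsmul_one]
    push_cast
    ring

end QuadraticExtension

/-! ### Vectors of given norm -/

section NormCount

variable {F V : Type*} [Field F] [AddCommGroup V] [Module F V] {σ : F →+* F}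
  {B : V →ₛₗ[σ] V →ₗ[F] F} {v : V}

/-- The number of vectors `x` of norm `B x x = a`. -/
noncomputable def normCount (B : V →ₛₗ[σ] V →ₗ[F] F) (a : F) : ℕ := Nat.card {x : V // B x x = a}

/-- The `1 × 1` matrix with entry `d`, the Gram matrix of a single vector of norm `d`. -/
abbrev singleGram (d : F) : Matrix Unit Unit F := Matrix.of fun _ _ => d

theorem single_mem_gramFrames : (fun _ : Unit => v) ∈ gramFrames B (singleGram (B v v)) :=
  fun _ _ => rfl

theorem card_gramFrames_singleGram (B : V →ₛₗ[σ] V →ₗ[F] F) (a : F) :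
    Nat.card (gramFrames B (singleGram a)) = normCount B a :=
  Nat.card_congr ((Equiv.funUnique Unit V).subtypeEquiv fun _ => ⟨fun h => h () (), fun h _ _ => h⟩)

theorem det_singleGram_ne_zero (hv : B v v ≠ 0) : (singleGram (B v v)).det ≠ 0 := by
  rwa [Matrix.det_unique]

theorem apply_smul_add_self (hB : B.IsRefl) (t : F) {y : V} (hy : B v y = 0) :
    B (t • v + y) (t • v + y) = σ t * B v v * t + B y y := by
  simp only [map_add, LinearMap.add_apply, map_smul, LinearMap.map_smulₛₗ, LinearMap.smul_apply,
    smul_eq_mul, hy, hB _ _ hy]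
  ring

theorem normCount_eq_sum_normCount_complForm [Fintype F] [Finite V] (hB : B.IsRefl)
    (hv : B v v ≠ 0) (a : F) :
    normCount B a =
      ∑ t : F, normCount (complForm B fun _ : Unit => v) (a - σ t * B v v * t) := by
  let split : (F × frameCompl B fun _ : Unit => v) ≃ₗ[F] V :=
    ((LinearEquiv.funUnique Unit F F).symm.prodCongr (LinearEquiv.refl F _)).trans
      (splitEquiv single_mem_gramFrames (det_singleGram_ne_zero hv))
  have hsplit (p) : split p = p.1 • v + p.2 := by
    change splitEquiv single_mem_gramFrames (det_singleGram_ne_zero hv) _ = _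
    rw [splitEquiv_apply]
    simp [Fintype.linearCombination_apply]
  have hnorm (p) : B (split p) (split p) = a ↔
      complForm B (fun _ : Unit => v) p.2 p.2 = a - σ p.1 * B v v * p.1 := by
    rw [hsplit, apply_smul_add_self hB _ (mem_frameCompl.1 p.2.2 ()), eq_sub_iff_add_eq']
    rfl
  unfold normCount
  rw [← Nat.card_sigma]
  exact Nat.card_congr ((split.toEquiv.subtypeEquiv fun p => (hnorm p).symm).symm.trans
    (Equiv.subtypeProdEquivSigmaSubtype fun t y =>
      complForm B (fun _ : Unit => v) y y = a - σ t * B v v * t))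

theorem normCount_of_subsingleton [Subsingleton V] [DecidableEq F] (a : F) :
    normCount B a = if a = 0 then 1 else 0 := by
  have hzero (x : V) : B x x = 0 := by rw [Subsingleton.elim x 0, map_zero]
  unfold normCount
  simp only [hzero]
  split_ifs with ha
  · rw [Nat.card_congr (Equiv.subtypeUnivEquiv fun _ => ha.symm), Nat.card_unique]
  · have : IsEmpty {_x : V // 0 = a} := ⟨fun x => ha x.2.symm⟩
    exact Nat.card_of_isEmpty

theorem card_mul_card_apply_eq_one [Fintype F] [Finite V] (hN : B.Nondegenerate) {u : V}
    (hu : u ≠ 0) : Fintype.card F * Nat.card {w : V // B u w = 1} = Nat.card V := by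
  obtain ⟨w, hw⟩ := exists_apply_eq_one hN hu
  have hcoset : Nat.card {w : V // B u w = 1} = Nat.card (LinearMap.ker (B u)) := by
    refine Nat.card_congr ((Equiv.subRight w).subtypeEquiv fun x => ?_)
    rw [LinearMap.mem_ker, Equiv.subRight_apply, map_sub, hw, sub_eq_zero]
  have hrange : Module.finrank F (LinearMap.range (B u)) = 1 := by
    rw [LinearMap.range_eq_top.2 fun t => ⟨t • w, by rw [map_smul, hw, smul_eq_mul, mul_one]⟩,
      finrank_top, Module.finrank_self]
  rw [hcoset, Module.natCard_eq_pow_finrank (K := F),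
    Module.natCard_eq_pow_finrank (K := F) (V := V),
    ← LinearMap.finrank_range_add_finrank_ker (B u), hrange, pow_add, pow_one,
    Nat.card_eq_fintype_card]

theorem card_isoVectors_add_one [Finite V] : Nat.card (isoVectors B) + 1 = normCount B 0 := by
  have hinsert : {x | B x x = 0} = insert 0 (isoVectors B) := by
    ext x
    by_cases hx : x = 0 <;> simp [isoVectors, hx]
  rw [normCount, ← Set.coe_ofPred, hinsert, Nat.card_coe_set_eq, Nat.card_coe_set_eq,
    Set.ncard_insert_of_notMem fun h => h.1 rfl]

namespace FormCase

variable {F₀ : Type*} [Field F₀] [Algebra F₀ F] {c : FormCase}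

theorem IsForm.exists_apply_self_ne_zero (hB : c.IsForm F₀ σ B) (hc : c ≠ alternating)
    (hN : B.Nondegenerate) [Nontrivial V] : ∃ v, B v v ≠ 0 := by
  by_contra! hself
  have hskew (x y : V) : B x y + B y x = 0 := by
    simpa [hself] using hself (x + y)
  obtain ⟨u, hu⟩ := exists_ne (0 : V)
  obtain ⟨w, hw⟩ := exists_apply_eq_one hN hu
  cases c with
  | alternating => exact hc rfl
  | symmetric =>
    obtain ⟨-, h2, -, hsymm⟩ := hB
    have := hskew u w
    rw [hsymm w u, hw, one_add_one_eq_two] at this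
    exact Ring.two_ne_zero h2 this
  | hermitian =>
    obtain ⟨-, -, hσ1, hherm⟩ := hB
    have htrace (t : F) : t + σ t = 0 := by
      have := hskew u (t • w)
      rwa [← hherm u (t • w), map_smul, hw, smul_eq_mul, mul_one] at this
    have htwo := htrace 1
    rw [map_one] at htwo
    refine hσ1 (RingHom.ext fun t => ?_)
    rw [RingHom.id_apply]
    linear_combination htrace t - t * htwo

variable [Fintype F] [DecidableEq F] {r : ℕ} {χ : ℤ}

theorem HasType.eq_one_of_zero (h : c.HasType B 0 χ) : χ = 1 := by
  obtain ⟨-, b, rfl⟩ := h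
  have : IsEmpty (Fin (c.gamma * 0)) := by
    rw [mul_zero]
    infer_instance
  rw [Matrix.det_isEmpty, sign_one]

theorem HasType.nontrivial (h : c.HasType B (r + 1) χ) : Nontrivial V := by
  refine Module.nontrivial_of_finrank_pos (R := F) ?_
  rw [h.finrank_eq]
  exact Nat.mul_pos c.gamma_pos r.succ_pos

variable [Finite V]

theorem HasType.subsingleton (h : c.HasType B 0 χ) : Subsingleton V :=
  Module.finrank_zero_iff.1 h.finrank_eq

theorem hasType_complForm_single (hB : c.IsForm F₀ σ B) (h : c.HasType B (r + 1) χ)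
    (hc : c.gamma = 1) (hv : B v v ≠ 0) :
    c.HasType (complForm B fun _ : Unit => v) r (χ * c.sign F (B v v)) := by
  rw [add_comm] at h
  have := hasType_complForm hB h single_mem_gramFrames (det_singleGram_ne_zero hv)
    (by rw [hc, Fintype.card_unit])
  rwa [Matrix.det_unique] at this

/-- The deviation of `q` times the number of vectors of norm `a` from `q ^ r`, in a nondegenerate
quadratic space of type `(r, χ)` over a field `F` with `q` elements. -/
def symmDeviation (F : Type*) [Field F] [Fintype F] [DecidableEq F] (r : ℕ) (χ : ℤ) (a : F) : ℤ :=
  if Even r then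
    Fintype.card F ^ (r / 2) * quadraticChar F (-1) ^ (r / 2) * χ *
      centeredDelta (Fintype.card F) a
  else Fintype.card F ^ (r / 2 + 1) * quadraticChar F (-1) ^ (r / 2) * χ * quadraticChar F a

theorem symmDeviation_two_mul (s : ℕ) (χ : ℤ) (a : F) :
    symmDeviation F (2 * s) χ a = Fintype.card F ^ s * quadraticChar F (-1) ^ s * χ *
      centeredDelta (Fintype.card F) a := by
  rw [symmDeviation, if_pos (even_two_mul s), Nat.mul_div_cancel_left _ two_pos]

theorem symmDeviation_two_mul_add_one (s : ℕ) (χ : ℤ) (a : F) :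
    symmDeviation F (2 * s + 1) χ a = Fintype.card F ^ (s + 1) * quadraticChar F (-1) ^ s * χ *
      quadraticChar F a := by
  rw [symmDeviation, if_neg (by simp), show (2 * s + 1) / 2 = s by omega]

theorem sum_symmDeviation (hF : ringChar F ≠ 2) {d : F} (hd : d ≠ 0) (r : ℕ) (χ : ℤ) (a : F) :
    ∑ x : F, symmDeviation F r (χ * quadraticChar F d) (a - x * d * x) =
      symmDeviation F (r + 1) χ a := by
  have hd2 := quadraticChar_sq_one hd
  rcases Nat.even_or_odd' r with ⟨s, rfl | rfl⟩
  · simp only [symmDeviation_two_mul, symmDeviation_two_mul_add_one, ← Finset.mul_sum,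
      sum_centeredDelta_sub_mul_mul_self hF hd]
    linear_combination ((Fintype.card F : ℤ) ^ (s + 1) * quadraticChar F (-1) ^ s * χ *
      quadraticChar F a) * hd2
  · simp only [show 2 * s + 1 + 1 = 2 * (s + 1) by ring, symmDeviation_two_mul,
      symmDeviation_two_mul_add_one, ← Finset.mul_sum, sum_quadraticChar_sub_mul_mul_self hF hd]
    linear_combination ((Fintype.card F : ℤ) ^ (s + 1) * quadraticChar F (-1) ^ (s + 1) * χ *
      centeredDelta (Fintype.card F) a) * hd2

theorem card_mul_normCount_symmetric (hB : symmetric.IsForm F₀ σ B)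
    (h : symmetric.HasType B r χ) (a : F) :
    (Fintype.card F * normCount B a : ℤ) = Fintype.card F ^ r + symmDeviation F r χ a := by
  induction r generalizing V χ a with
  | zero =>
    have := h.subsingleton
    obtain rfl := h.eq_one_of_zero
    rw [normCount_of_subsingleton, symmDeviation_two_mul 0, centeredDelta]
    push_cast
    ring
  | succ r ih =>
    have := h.nontrivial
    obtain ⟨v, hv⟩ := hB.exists_apply_self_ne_zero (by simp) h.1
    have hW := hasType_complForm_single hB h rfl hv
    have hσ (x : F) : σ x = x := by rw [hB.2.2.1, RingHom.id_apply]
    rw [normCount_eq_sum_normCount_complForm hB.isRefl hv, Nat.cast_sum, Finset.mul_sum,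
      Finset.sum_congr rfl fun x _ => ih (hB.restrict _) hW _, Finset.sum_add_distrib,
      ← sum_symmDeviation hB.2.1 hv]
    simp [pow_succ', sign, hσ]

theorem card_mul_normCount_hermitian [Fintype F₀] [DecidableEq F₀] (hB : hermitian.IsForm F₀ σ B)
    (h : hermitian.HasType B r χ) (a : F₀) :
    (Fintype.card F₀ * normCount B (algebraMap F₀ F a) : ℤ) = Fintype.card F₀ ^ (2 * r) +
      (-Fintype.card F₀) ^ r * centeredDelta (Fintype.card F₀) a := by
  induction r generalizing V χ a with
  | zero =>
    have := h.subsingleton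
    rw [normCount_of_subsingleton, centeredDelta]
    simp only [FaithfulSMul.algebraMap_eq_zero_iff]
    push_cast
    ring
  | succ r ih =>
    have := h.nontrivial
    obtain ⟨v, hv⟩ := hB.exists_apply_self_ne_zero (by simp) h.1
    have hW := hasType_complForm_single hB h rfl hv
    obtain ⟨h2, hσ, hσ1, hherm⟩ := id hB
    obtain ⟨d, hd⟩ := exists_algebraMap_eq_of_fixed h2 hσ hσ1 (hherm v v)
    have hd0 : d ≠ 0 := by
      rintro rfl
      exact hv (by rw [← hd, map_zero])
    have hsub (x : F) : algebraMap F₀ F a - σ x * B v v * x =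
        algebraMap F₀ F (a - d * Algebra.norm F₀ x) := by
      rw [map_sub, map_mul, algebraMap_norm_eq_mul h2 hσ hσ1, hd]
      ring
    rw [normCount_eq_sum_normCount_complForm hB.isRefl hv, Nat.cast_sum, Finset.mul_sum,
      Finset.sum_congr rfl fun x _ => by rw [hsub x, ih (hB.restrict _) hW _],
      Finset.sum_add_distrib, ← Finset.mul_sum, sum_centeredDelta_norm h2 hd0, Finset.sum_const,
      Finset.card_univ, card_eq_sq_of_finrank_eq_two h2, nsmul_eq_mul]
    push_cast
    ring

end FormCase

end NormCount

/-! ### Orders of isometry groups -/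

section Orders

/-- The exponent of `q` in the order of an orthogonal group in dimension `r`. -/
def orthogonalExponent (r : ℕ) : ℕ := (r / 2).choose 2 + ((r + 1) / 2).choose 2

/-- The order of the isometry group of a space of type `(r, χ)`, where `q₀ = #F₀`, `q = #F` and
`ε = sign (-1)`. In the symmetric case with `r = 0` this is correct for `χ = 1` only: there is no
space of type `(0, -1)`, and division by zero gives the value `0`. -/
def isomOrder (c : FormCase) (q₀ q : ℕ) (ε : ℤ) (r : ℕ) (χ : ℤ) : ℚ :=
  match c with
  | FormCase.hermitian =>
      (-1) ^ r * (-(q₀ : ℚ)) ^ r.choose 2 * qFalling (-(q₀ : ℚ)) r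
  | FormCase.symmetric =>
      2 * (q : ℚ) ^ orthogonalExponent r * qFalling ((q : ℚ) ^ 2) (r / 2) / eFactor q ε r χ
  | FormCase.alternating => (q : ℚ) ^ (r ^ 2) * qFalling ((q : ℚ) ^ 2) r

/-- The order of the unipotent radical of the stabilizer of an `m`-dimensional isotropic space
`R`, where `R^⊥ / R` has type `(k, _)`. -/
def unipotentOrder (c : FormCase) (q₀ q : ℕ) (k m : ℕ) : ℚ :=
  match c with
  | FormCase.hermitian => (q₀ : ℚ) ^ (2 * (m * k + m.choose 2) + m)
  | FormCase.symmetric => (q : ℚ) ^ (m * k + m.choose 2)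
  | FormCase.alternating => (q : ℚ) ^ (2 * m * k + (m + 1).choose 2)

variable {c : FormCase} {q₀ q : ℕ} {ε χ : ℤ}

theorem unipotentOrder_zero (c : FormCase) (q₀ q k : ℕ) : unipotentOrder c q₀ q k 0 = 1 := by
  cases c <;> simp [unipotentOrder]

theorem unipotentOrder_succ_mul (hc : c = .hermitian → q = q₀ ^ 2) (k m : ℕ) :
    unipotentOrder c q₀ q k (m + 1) * (q : ℚ) ^ m =
      unipotentOrder c q₀ q (k + 2 / c.gamma * m) 1 * unipotentOrder c q₀ q k m := by
  cases c with
  | hermitian =>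
    simp only [unipotentOrder, hc rfl, FormCase.gamma, Nat.choose_succ_succ' m 1,
      Nat.choose_one_right, show Nat.choose 1 2 = 0 from rfl]
    push_cast
    ring
  | symmetric =>
    simp only [unipotentOrder, FormCase.gamma, Nat.choose_succ_succ' m 1, Nat.choose_one_right,
      show Nat.choose 1 2 = 0 from rfl]
    ring
  | alternating =>
    simp only [unipotentOrder, FormCase.gamma, Nat.choose_succ_succ' (m + 1) 1,
      Nat.choose_one_right, Nat.choose_self]
    ring

theorem unipotentOrder_mul_pow (hc : c = .hermitian → q = q₀ ^ 2) (n k m : ℕ) :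
    unipotentOrder c q₀ q k m * (q : ℚ) ^ (m * (c.gamma * n)) =
      unipotentOrder c q₀ q (n + k) m := by
  cases c with
  | hermitian =>
    simp only [unipotentOrder, hc rfl, FormCase.gamma]
    push_cast
    ring
  | _ =>
    simp only [unipotentOrder, FormCase.gamma]
    ring

theorem eFactor_two_mul (q : ℕ) (ε : ℤ) (s : ℕ) (χ : ℤ) :
    eFactor q ε (2 * s) χ = (q : ℚ) ^ s + (ε : ℚ) ^ s * χ := by
  rw [eFactor, if_pos (even_two_mul s), Nat.mul_div_cancel_left _ two_pos]

theorem eFactor_two_mul_add_one (q : ℕ) (ε : ℤ) (s : ℕ) (χ : ℤ) :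
    eFactor q ε (2 * s + 1) χ = 1 := by
  rw [eFactor, if_neg (by simp)]

theorem isomOrder_symmetric_two_mul (q₀ q : ℕ) (ε : ℤ) (s : ℕ) (χ : ℤ) :
    isomOrder .symmetric q₀ q ε (2 * s) χ = 2 * (q : ℚ) ^ (s.choose 2 + s.choose 2) *
      qFalling ((q : ℚ) ^ 2) s / ((q : ℚ) ^ s + (ε : ℚ) ^ s * χ) := by
  rw [isomOrder, orthogonalExponent, eFactor_two_mul, show 2 * s / 2 = s by omega,
    show (2 * s + 1) / 2 = s by omega]

theorem isomOrder_symmetric_two_mul_add_one (q₀ q : ℕ) (ε : ℤ) (s : ℕ) (χ : ℤ) :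
    isomOrder .symmetric q₀ q ε (2 * s + 1) χ = 2 * (q : ℚ) ^ (s.choose 2 + (s.choose 2 + s)) *
      qFalling ((q : ℚ) ^ 2) s := by
  rw [isomOrder, orthogonalExponent, eFactor_two_mul_add_one, show (2 * s + 1) / 2 = s by omega,
    show (2 * s + 1 + 1) / 2 = s + 1 by omega, div_one, Nat.choose_succ_succ' s 1,
    Nat.choose_one_right, add_comm s]

theorem isomOrder_zero_one (c : FormCase) (q₀ q : ℕ) (ε : ℤ) : isomOrder c q₀ q ε 0 1 = 1 := by
  cases c <;> norm_num [isomOrder, orthogonalExponent, qFalling_zero, eFactor]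

theorem qFalling_sq_ne_zero (hq : 1 < q) (n : ℕ) : qFalling ((q : ℚ) ^ 2) n ≠ 0 := by
  refine qFalling_ne_zero ?_ n
  rw [abs_of_nonneg (by positivity)]
  exact one_lt_pow₀ (Nat.one_lt_cast.2 hq) two_ne_zero

theorem qFalling_neg_ne_zero (hq₀ : 1 < q₀) (n : ℕ) : qFalling (-(q₀ : ℚ)) n ≠ 0 := by
  refine qFalling_ne_zero ?_ n
  rwa [abs_neg, Nat.abs_cast, Nat.one_lt_cast]

theorem sq_cast_pow_mul_eq_one (hε : ε ^ 2 = 1) (hχ : χ ^ 2 = 1) (s : ℕ) :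
    ((ε : ℚ) ^ s * χ) ^ 2 = 1 := by
  rw [mul_pow, pow_right_comm]
  norm_cast
  rw [hε, hχ, one_pow, mul_one]

theorem qFalling_cast_ne_zero (hq : 1 < q) (n : ℕ) : qFalling (q : ℚ) n ≠ 0 := by
  refine qFalling_ne_zero ?_ n
  rwa [Nat.abs_cast, Nat.one_lt_cast]

theorem eFactor_ne_zero (hq : 1 < q) (hε : ε ^ 2 = 1) (hχ : χ ^ 2 = 1) {r : ℕ}
    (hr : 0 < r ∨ χ = 1) : eFactor q ε r χ ≠ 0 := by
  rcases Nat.even_or_odd' r with ⟨s, rfl | rfl⟩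
  · rw [eFactor_two_mul]
    rcases Nat.eq_zero_or_pos s with rfl | hs
    · obtain rfl : χ = 1 := hr.resolve_left (lt_irrefl 0)
      norm_num
    · intro h0
      have hsq : ((q : ℚ) ^ s) ^ 2 = 1 := by
        rw [eq_neg_of_add_eq_zero_left h0, neg_sq, sq_cast_pow_mul_eq_one hε hχ]
      exact (one_lt_pow₀ (one_lt_pow₀ (Nat.one_lt_cast.2 hq) hs.ne') two_ne_zero).ne' hsq
  · rw [eFactor_two_mul_add_one]
    exact one_ne_zero

theorem isomOrder_ne_zero (c : FormCase) (hq₀ : 1 < q₀) (hq : 1 < q) (hε : ε ^ 2 = 1)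
    (hχ : χ ^ 2 = 1) {r : ℕ} (hr : 0 < r ∨ χ = 1) : isomOrder c q₀ q ε r χ ≠ 0 := by
  have hq0 : (q : ℚ) ≠ 0 := Nat.cast_ne_zero.2 (by omega)
  have hq₀0 : (q₀ : ℚ) ≠ 0 := Nat.cast_ne_zero.2 (by omega)
  cases c with
  | hermitian =>
    exact mul_ne_zero (mul_ne_zero (pow_ne_zero _ (neg_ne_zero.2 one_ne_zero))
      (pow_ne_zero _ (neg_ne_zero.2 hq₀0))) (qFalling_neg_ne_zero hq₀ r)
  | symmetric =>
    exact div_ne_zero (mul_ne_zero (mul_ne_zero two_ne_zero (pow_ne_zero _ hq0))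
      (qFalling_sq_ne_zero hq _)) (eFactor_ne_zero hq hε hχ hr)
  | alternating => exact mul_ne_zero (pow_ne_zero _ hq0) (qFalling_sq_ne_zero hq r)

theorem div_isomOrder_mul_div_cancel (c : FormCase) (hq₀ : 1 < q₀) (hq : 1 < q) (hε : ε ^ 2 = 1)
    (hχ : χ ^ 2 = 1) {s t : ℕ} {χ' : ℤ} (hst : 0 < s ∨ t = s ∧ χ' = χ) (a : ℚ) :
    a / isomOrder c q₀ q ε s χ * (isomOrder c q₀ q ε s χ / isomOrder c q₀ q ε t χ') =
      a / isomOrder c q₀ q ε t χ' := by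
  rcases eq_or_ne (isomOrder c q₀ q ε s χ) 0 with h0 | h0
  · obtain ⟨rfl, rfl⟩ :=
      hst.resolve_left fun hs => isomOrder_ne_zero c hq₀ hq hε hχ (Or.inl hs) h0
    rw [h0, div_zero, zero_mul]
  · exact div_mul_div_cancel₀ h0

theorem isomOrder_hermitian_succ_div (hq₀ : 1 < q₀) (r : ℕ) (ψ : ℤ) :
    isomOrder .hermitian q₀ q ε (r + 1) χ / isomOrder .hermitian q₀ q ε r ψ =
      -(-(q₀ : ℚ)) ^ r * ((-(q₀ : ℚ)) ^ (r + 1) - 1) := by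
  have hx : -(q₀ : ℚ) ≠ 0 := neg_ne_zero.2 (Nat.cast_ne_zero.2 (by omega))
  have hfall := qFalling_neg_ne_zero hq₀ r
  simp only [isomOrder, qFalling_succ, Nat.choose_succ_succ' r 1, Nat.choose_one_right]
  generalize -(q₀ : ℚ) = x at *
  field_simp
  ring

theorem isomOrder_alternating_succ_div (hq : 1 < q) (r : ℕ) (ψ : ℤ) :
    isomOrder .alternating q₀ q ε (r + 1) χ / isomOrder .alternating q₀ q ε r ψ =
      (q : ℚ) ^ (2 * r + 1) * ((q : ℚ) ^ (2 * r + 2) - 1) := by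
  have hfall := qFalling_sq_ne_zero hq r
  simp only [isomOrder, qFalling_succ]
  field_simp
  ring

theorem isomOrder_symmetric_odd_div_even (hq : 1 < q) (s : ℕ) (ψ : ℤ) :
    isomOrder .symmetric q₀ q ε (2 * s + 1) χ / isomOrder .symmetric q₀ q ε (2 * s) ψ =
      (q : ℚ) ^ s * ((q : ℚ) ^ s + (ε : ℚ) ^ s * ψ) := by
  have hfall := qFalling_sq_ne_zero hq s
  rw [isomOrder_symmetric_two_mul_add_one, isomOrder_symmetric_two_mul, div_div_eq_mul_div]
  field_simp
  ring

theorem isomOrder_symmetric_even_div_odd (hq : 1 < q) (hε : ε ^ 2 = 1) (hχ : χ ^ 2 = 1) (s : ℕ)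
    (ψ : ℤ) :
    isomOrder .symmetric q₀ q ε (2 * s + 2) χ / isomOrder .symmetric q₀ q ε (2 * s + 1) ψ =
      (q : ℚ) ^ s * ((q : ℚ) ^ (s + 1) - (ε : ℚ) ^ (s + 1) * χ) := by
  have hfall := qFalling_sq_ne_zero hq s
  have he := eFactor_ne_zero hq hε hχ (r := 2 * (s + 1)) (Or.inl (by omega))
  have hsq := sq_cast_pow_mul_eq_one hε hχ (s + 1)
  rw [eFactor_two_mul] at he
  rw [show 2 * s + 2 = 2 * (s + 1) by ring, isomOrder_symmetric_two_mul_add_one,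
    isomOrder_symmetric_two_mul, qFalling_succ, pow_right_comm, Nat.choose_succ_succ' s 1,
    Nat.choose_one_right]
  generalize (ε : ℚ) ^ (s + 1) * χ = e at *
  rw [div_div, div_eq_iff (mul_ne_zero he (by positivity))]
  linear_combination (2 * (q : ℚ) ^ (2 * s + 2 * s.choose 2) * qFalling ((q : ℚ) ^ 2) s) * hsq

end Orders

/-! ### Isotropic vectors and isotropic frames -/

section IsotropicCounts

universe u

namespace FormCase

/-- The order of the isometry group of a space of type `(r, χ)` over `F`. -/
abbrev formOrder (F₀ F : Type*) [Fintype F₀] [Field F] [Fintype F] [DecidableEq F] (c : FormCase)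
    (r : ℕ) (χ : ℤ) : ℚ :=
  isomOrder c (Fintype.card F₀) (Fintype.card F) (c.sign F (-1)) r χ

section Orders

variable {F₀ F : Type*} [Fintype F₀] [Field F] [Fintype F] [DecidableEq F] {c : FormCase} {χ : ℤ}

theorem formOrder_zero_of_ne_one {ψ : ℤ} (hψ : ψ ∈ c.Sign) (hψ1 : ψ ≠ 1) :
    formOrder F₀ F c 0 ψ = 0 := by
  cases c with
  | symmetric =>
    obtain rfl : ψ = -1 := hψ.resolve_left hψ1
    simp [formOrder, isomOrder, eFactor]
  | _ => exact absurd hψ hψ1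

theorem pos_or_mul_sign_pow_eq (c : FormCase) (l m : ℕ) (χ : ℤ) :
    0 < l + 2 / c.gamma * m ∨ l = l + 2 / c.gamma * m ∧ χ * c.sign F (-1) ^ m = χ := by
  rcases Nat.eq_zero_or_pos m with rfl | hm
  · exact Or.inr ⟨rfl, by rw [pow_zero, mul_one]⟩
  · have hplane : 0 < 2 / c.gamma := by cases c <;> simp [gamma]
    exact Or.inl (Nat.add_pos_right l (Nat.mul_pos hplane hm))

theorem sign_neg_one_sq (c : FormCase) : c.sign F (-1) ^ 2 = 1 := by
  rw [sq, sign_mul_self c (neg_ne_zero.2 one_ne_zero)]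

variable [Field F₀]

theorem formOrder_ne_zero (c : FormCase) (hχ : χ ^ 2 = 1) {r : ℕ} (hr : 0 < r ∨ χ = 1) :
    formOrder F₀ F c r χ ≠ 0 :=
  isomOrder_ne_zero c Fintype.one_lt_card Fintype.one_lt_card (sign_neg_one_sq c) hχ hr

theorem div_formOrder_mul_div_cancel (c : FormCase) (hχ : χ ^ 2 = 1) {s t : ℕ} {χ' : ℤ}
    (hst : 0 < s ∨ t = s ∧ χ' = χ) (a : ℚ) :
    a / formOrder F₀ F c s χ * (formOrder F₀ F c s χ / formOrder F₀ F c t χ') =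
      a / formOrder F₀ F c t χ' :=
  div_isomOrder_mul_div_cancel c Fintype.one_lt_card Fintype.one_lt_card (sign_neg_one_sq c) hχ
    hst a

end Orders

variable {F₀ F : Type*} {V : Type u} [Field F₀] [Field F] [Algebra F₀ F] [AddCommGroup V]
  [Module F V] {c : FormCase} {σ : F →+* F} {B : V →ₛₗ[σ] V →ₗ[F] F}

theorem card_fin_two_eq_gamma_mul (c : FormCase) :
    Fintype.card (Fin 2) = c.gamma * (2 / c.gamma) := by
  cases c <;> rfl

theorem IsForm.card_eq_sq [Fintype F₀] [Fintype F] (hB : c.IsForm F₀ σ B) :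
    c = hermitian → Fintype.card F = Fintype.card F₀ ^ 2 := by
  rintro rfl
  exact card_eq_sq_of_finrank_eq_two hB.1

variable [Fintype F] [DecidableEq F] {r : ℕ} {χ : ℤ}

theorem HasType.sq_eq_one (hB : B.IsRefl) (h : c.HasType B r χ) : χ ^ 2 = 1 := by
  rw [sq, h.mul_self_eq_one hB]

theorem HasType.pos_or_eq_one (h : c.HasType B r χ) : 0 < r ∨ χ = 1 := by
  rcases Nat.eq_zero_or_pos r with rfl | hr
  · exact Or.inr h.eq_one_of_zero
  · exact Or.inl hr

theorem sign_det_pairGram (hB : c.IsForm F₀ σ B) {u w : V} (hu : B u u = 0) (hw : B u w = 1) :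
    c.sign F (pairGram B u w).det = c.sign F (-1) := by
  cases c with
  | symmetric => rw [det_pairGram hu, hB.2.2.2 w u, hw, one_mul]
  | _ => rfl

variable [Finite V]

theorem hasType_complForm_pair (hB : c.IsForm F₀ σ B) (h : c.HasType B (r + 2 / c.gamma) χ)
    {u w : V} (hu : B u u = 0) (hw : B u w = 1) :
    c.HasType (complForm B ![u, w]) r (χ * c.sign F (-1)) := by
  rw [add_comm] at h
  rw [← sign_det_pairGram hB hu hw]
  exact hasType_complForm hB h (pair_mem_gramFrames u w) (det_pairGram_ne_zero hB.isRefl hu hw)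
    (card_fin_two_eq_gamma_mul c)

variable [Fintype F₀]

theorem normCount_symmetric (hB : symmetric.IsForm F₀ σ B) (h : symmetric.HasType B (r + 1) χ)
    {a : F} (ha : a ≠ 0) :
    (normCount B a : ℚ) = formOrder F₀ F symmetric (r + 1) χ /
      formOrder F₀ F symmetric r (χ * symmetric.sign F a) := by
  have hcount : (Fintype.card F * normCount B a : ℚ) =
      Fintype.card F ^ (r + 1) + (symmDeviation F (r + 1) χ a : ℤ) := by
    exact_mod_cast card_mul_normCount_symmetric hB h a
  refine mul_left_cancel₀ (Nat.cast_ne_zero.2 Fintype.card_ne_zero) (hcount.trans ?_)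
  rcases Nat.even_or_odd' r with ⟨s, rfl | rfl⟩
  · rw [isomOrder_symmetric_odd_div_even Fintype.one_lt_card, symmDeviation_two_mul_add_one]
    push_cast [sign]
    ring
  · rw [isomOrder_symmetric_even_div_odd Fintype.one_lt_card (sign_neg_one_sq _)
      (h.sq_eq_one hB.isRefl), show 2 * s + 1 + 1 = 2 * (s + 1) by ring, symmDeviation_two_mul,
      centeredDelta, if_neg ha]
    push_cast [sign]
    ring

theorem normCount_hermitian (hB : hermitian.IsForm F₀ σ B) (h : hermitian.HasType B (r + 1) χ)
    (ψ : ℤ) :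
    (normCount B 1 : ℚ) = formOrder F₀ F hermitian (r + 1) χ / formOrder F₀ F hermitian r ψ := by
  classical
  have hcount : (Fintype.card F₀ * normCount B (1 : F) : ℚ) = Fintype.card F₀ ^ (2 * (r + 1)) +
      (-Fintype.card F₀) ^ (r + 1) * (centeredDelta (Fintype.card F₀) (1 : F₀) : ℤ) := by
    have := card_mul_normCount_hermitian hB h (1 : F₀)
    rw [map_one] at this
    exact_mod_cast this
  refine mul_left_cancel₀ (Nat.cast_ne_zero.2 Fintype.card_ne_zero) (hcount.trans ?_)
  rw [isomOrder_hermitian_succ_div Fintype.one_lt_card, centeredDelta, if_neg one_ne_zero,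
    pow_mul, ← neg_sq, ← pow_mul]
  push_cast
  ring

theorem card_isoVectors_symmetric (hB : symmetric.IsForm F₀ σ B)
    (h : symmetric.HasType B (r + 2) χ) :
    (Nat.card (isoVectors B) : ℚ) = formOrder F₀ F symmetric (r + 2) χ /
      formOrder F₀ F symmetric r (χ * symmetric.sign F (-1)) / Fintype.card F ^ r := by
  have hq : (Fintype.card F : ℚ) ≠ 0 := Nat.cast_ne_zero.2 Fintype.card_ne_zero
  have hε := sign_neg_one_sq (F := F) symmetric
  have hχ := h.sq_eq_one hB.isRefl
  have hcount : (Fintype.card F * (Nat.card (isoVectors B) + 1) : ℚ) =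
      Fintype.card F ^ (r + 2) + (symmDeviation F (r + 2) χ 0 : ℤ) := by
    have := card_mul_normCount_symmetric hB h 0
    rw [← card_isoVectors_add_one] at this
    exact_mod_cast this
  rw [eq_div_iff (pow_ne_zero _ hq),
    ← div_formOrder_mul_div_cancel symmetric hχ (s := r + 1) (Or.inl r.succ_pos)]
  refine mul_left_cancel₀ hq ?_
  rw [← mul_assoc, eq_sub_of_add_eq ((mul_add_one _ _).symm.trans hcount)]
  rcases Nat.even_or_odd' r with ⟨s, rfl | rfl⟩
  · have hsq := sq_cast_pow_mul_eq_one hε hχ (s + 1)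
    rw [isomOrder_symmetric_even_div_odd Fintype.one_lt_card hε hχ,
      isomOrder_symmetric_odd_div_even Fintype.one_lt_card,
      show 2 * s + 2 = 2 * (s + 1) by ring, symmDeviation_two_mul, centeredDelta, if_pos rfl]
    push_cast [sign] at hsq ⊢
    linear_combination ((Fintype.card F : ℚ) ^ (2 * s + 1)) * hsq
  · have hsq := sq_cast_pow_mul_eq_one hε hχ (s + 1)
    rw [show 2 * s + 1 + 2 = 2 * (s + 1) + 1 by ring, show 2 * s + 1 + 1 = 2 * (s + 1) by ring,
      isomOrder_symmetric_odd_div_even Fintype.one_lt_card,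
      show 2 * (s + 1) = 2 * s + 2 by ring,
      isomOrder_symmetric_even_div_odd Fintype.one_lt_card hε hχ,
      show 2 * s + 2 + 1 = 2 * (s + 1) + 1 by ring, symmDeviation_two_mul_add_one]
    push_cast [sign, quadraticChar_zero] at hsq ⊢
    linear_combination ((Fintype.card F : ℚ) ^ (2 * s + 2)) * hsq

theorem card_isoVectors_hermitian (hB : hermitian.IsForm F₀ σ B)
    (h : hermitian.HasType B (r + 2) χ) (ψ : ℤ) :
    (Nat.card (isoVectors B) : ℚ) = formOrder F₀ F hermitian (r + 2) χ /
      formOrder F₀ F hermitian r ψ / Fintype.card F₀ ^ (2 * r + 1) := by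
  classical
  have hq₀ : (Fintype.card F₀ : ℚ) ≠ 0 := Nat.cast_ne_zero.2 Fintype.card_ne_zero
  have hcount : (Fintype.card F₀ * (Nat.card (isoVectors B) + 1) : ℚ) =
      Fintype.card F₀ ^ (2 * (r + 2)) +
        (-Fintype.card F₀) ^ (r + 2) * (centeredDelta (Fintype.card F₀) (0 : F₀) : ℤ) := by
    have := card_mul_normCount_hermitian hB h (0 : F₀)
    rw [map_zero, ← card_isoVectors_add_one] at this
    exact_mod_cast this
  rw [eq_div_iff (pow_ne_zero _ hq₀), ← div_formOrder_mul_div_cancel hermitian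
      (h.sq_eq_one hB.isRefl) (s := r + 1) (Or.inl r.succ_pos),
    isomOrder_hermitian_succ_div Fintype.one_lt_card,
    isomOrder_hermitian_succ_div Fintype.one_lt_card]
  refine mul_left_cancel₀ hq₀ ?_
  rw [← mul_assoc, eq_sub_of_add_eq ((mul_add_one _ _).symm.trans hcount), centeredDelta,
    if_pos rfl]
  push_cast
  obtain ⟨x, hx⟩ : ∃ x, (Fintype.card F₀ : ℚ) = -x := ⟨_, (neg_neg _).symm⟩
  have heven (k : ℕ) : (-x) ^ (2 * k) = x ^ (2 * k) := by rw [pow_mul, pow_mul, neg_sq]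
  rw [hx, neg_neg, pow_succ (-x), heven, heven]
  ring

theorem card_isoVectors_alternating (hB : alternating.IsForm F₀ σ B)
    (h : alternating.HasType B (r + 1) χ) (ψ : ℤ) :
    (Nat.card (isoVectors B) : ℚ) = formOrder F₀ F alternating (r + 1) χ /
      formOrder F₀ F alternating r ψ / Fintype.card F ^ (2 * r + 1) := by
  have hcard : normCount B 0 = Fintype.card F ^ (2 * r + 2) := by
    have : Module.Finite F V := Module.Finite.of_finite
    rw [normCount, Nat.card_congr (Equiv.subtypeUnivEquiv hB.2.2),
      Module.natCard_eq_pow_finrank (K := F), h.finrank_eq, Nat.card_eq_fintype_card]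
    rfl
  rw [isomOrder_alternating_succ_div Fintype.one_lt_card,
    mul_div_cancel_left₀ _ (pow_ne_zero _ (Nat.cast_ne_zero.2 Fintype.card_ne_zero)),
    eq_sub_iff_add_eq]
  exact_mod_cast card_isoVectors_add_one.trans hcard

theorem card_isoVectors (hB : c.IsForm F₀ σ B) (h : c.HasType B (r + 2 / c.gamma) χ) :
    (Nat.card (isoVectors B) : ℚ) = formOrder F₀ F c (r + 2 / c.gamma) χ /
      formOrder F₀ F c r (χ * c.sign F (-1)) /
        unipotentOrder c (Fintype.card F₀) (Fintype.card F) r 1 := by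
  cases c with
  | hermitian => simpa [unipotentOrder, gamma] using card_isoVectors_hermitian hB h _
  | symmetric => simpa [unipotentOrder, gamma] using card_isoVectors_symmetric hB h
  | alternating => simpa [unipotentOrder, gamma] using card_isoVectors_alternating hB h _

theorem card_isoFrames (hB : c.IsForm F₀ σ B) {l m : ℕ}
    (h : c.HasType B (l + 2 / c.gamma * m) χ) :
    (Nat.card (isoFrames B m) : ℚ) = formOrder F₀ F c (l + 2 / c.gamma * m) χ /
      formOrder F₀ F c l (χ * c.sign F (-1) ^ m) /
        unipotentOrder c (Fintype.card F₀) (Fintype.card F) l m := by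
  induction m generalizing V χ with
  | zero =>
    have hne := formOrder_ne_zero (F₀ := F₀) (F := F) c (h.sq_eq_one hB.isRefl) h.pos_or_eq_one
    rw [card_isoFrames_zero, unipotentOrder_zero, div_one, Nat.cast_one, pow_zero, mul_one]
    exact (div_self hne).symm
  | succ m ih =>
    rw [mul_add_one, ← add_assoc] at h ⊢
    have hχ : (χ * c.sign F (-1)) ^ 2 = 1 := by
      rw [mul_pow, h.sq_eq_one hB.isRefl, sign_neg_one_sq, one_mul]
    have hcancel := div_formOrder_mul_div_cancel (F₀ := F₀) (F := F) c hχ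
      (pos_or_mul_sign_pow_eq (F := F) c l m _)
      (formOrder F₀ F c (l + 2 / c.gamma * m + 2 / c.gamma) χ)
    have hunip := unipotentOrder_succ_mul hB.card_eq_sq l m
    have hpow : (Fintype.card F : ℚ) ^ m ≠ 0 :=
      pow_ne_zero _ (Nat.cast_ne_zero.2 Fintype.card_ne_zero)
    rw [card_isoFrames_succ hB.isRefl h.1 fun u w hu hw =>
        ih (hB.restrict _) (hasType_complForm_pair hB h hu hw),
      card_isoVectors hB h, pow_succ', ← mul_assoc χ, Nat.card_eq_fintype_card, ← hcancel,
      div_eq_mul_inv _ (unipotentOrder _ _ _ l (m + 1)), ← div_mul_cancel_right₀ hpow, hunip]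
    ring

end FormCase

end IsotropicCounts

/-! ### Frames with a prescribed Gram matrix -/

section GramCounts

universe u

namespace FormCase

section SymplecticPairs

variable {F₀ F V : Type*} [Field F₀] [Field F] [Algebra F₀ F] [AddCommGroup V] [Module F V]
  {σ : F →+* F} {B : V →ₛₗ[σ] V →ₗ[F] F}

/-- The Gram matrix of a symplectic pair. -/
abbrev symplecticGram (F : Type*) [Field F] : Matrix (Fin 2) (Fin 2) F := !![0, 1; -1, 0]

theorem pair_mem_gramFrames_symplecticGram (hB : alternating.IsForm F₀ σ B) {u w : V}
    (huw : B u w = 1) : ![u, w] ∈ gramFrames B (symplecticGram F) := by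
  have hwu : B w u = -1 := by rw [← huw, LinearMap.IsAlt.neg hB.2.2]
  intro i j
  fin_cases i <;> fin_cases j
  exacts [hB.2.2 u, huw, hwu, hB.2.2 w]

/-- A symplectic pair is a nonzero vector with a vector pairing to `1` with it. -/
def gramFramesSymplecticEquiv (hB : alternating.IsForm F₀ σ B) :
    gramFrames B (symplecticGram F) ≃ Σ u : isoVectors B, {w : V // B u.1 w = 1} where
  toFun f := ⟨⟨f.1 0, by
    have huw : B (f.1 0) (f.1 1) = 1 := f.2 0 1
    intro h
    simp [h] at huw, f.2 0 0⟩, ⟨f.1 1, f.2 0 1⟩⟩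
  invFun p := ⟨![p.1.1, p.2.1], pair_mem_gramFrames_symplecticGram hB p.2.2⟩
  left_inv f := by
    refine Subtype.ext (funext fun i => ?_)
    fin_cases i <;> rfl
  right_inv _ := rfl

end SymplecticPairs

section WittCount

variable (F₀ : Type*) {F : Type*} [Field F₀] [Fintype F₀] [Field F] [Algebra F₀ F] [Fintype F]
  [DecidableEq F] {c : FormCase} {σ : F →+* F}

/-- Witt's theorem in numerical form: in a space of type `(n + r, χ)` the families with Gram matrix
`G` are as many as the cosets of the isometry group of the orthogonal complement of one of them.
Here `G` is the Gram matrix of a space of type `(n, sign (det G))`. -/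
def WittCount (c : FormCase) (σ : F →+* F) {ι : Type*} [Fintype ι] [DecidableEq ι]
    (G : Matrix ι ι F) (n : ℕ) : Prop :=
  ∀ (V : Type u) [AddCommGroup V] [Module F V] [Finite V] (B : V →ₛₗ[σ] V →ₗ[F] F),
    c.IsForm F₀ σ B → ∀ (r : ℕ) (χ : ℤ), c.HasType B (n + r) χ →
      (Nat.card (gramFrames B G) : ℚ) =
        formOrder F₀ F c (n + r) χ / formOrder F₀ F c r (χ * c.sign F G.det)

theorem wittCount_hermitian_singleGram_one (σ : F →+* F) :
    WittCount.{u} F₀ hermitian σ (singleGram (1 : F)) 1 := by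
  intro V _ _ _ B hB r χ h
  rw [add_comm] at h ⊢
  rw [card_gramFrames_singleGram, normCount_hermitian hB h]

theorem wittCount_symmetric_singleGram (σ : F →+* F) {a : F} (ha : a ≠ 0) :
    WittCount.{u} F₀ symmetric σ (singleGram a) 1 := by
  intro V _ _ _ B hB r χ h
  rw [add_comm] at h ⊢
  rw [card_gramFrames_singleGram, normCount_symmetric hB h ha, Matrix.det_unique]
  rfl

theorem wittCount_symplecticGram (σ : F →+* F) :
    WittCount.{u} F₀ alternating σ (symplecticGram F) 1 := by
  intro V _ _ _ B hB r χ h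
  have hq : (Fintype.card F : ℚ) ≠ 0 := Nat.cast_ne_zero.2 Fintype.card_ne_zero
  have : Module.Finite F V := Module.Finite.of_finite
  rw [add_comm] at h ⊢
  have hV : Nat.card V = Fintype.card F * Fintype.card F ^ (2 * r + 1) := by
    rw [Module.natCard_eq_pow_finrank (K := F), h.finrank_eq, Nat.card_eq_fintype_card,
      ← pow_succ']
    rfl
  have hpairs (u : isoVectors B) :
      (Nat.card {w : V // B u.1 w = 1} : ℚ) = (Fintype.card F : ℚ) ^ (2 * r + 1) := by
    have := (card_mul_card_apply_eq_one h.1 u.2.1).trans hV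
    exact_mod_cast Nat.eq_of_mul_eq_mul_left Fintype.card_pos this
  rw [Nat.card_congr (gramFramesSymplecticEquiv hB), cast_card_sigma_of_card_eq hpairs,
    card_isoVectors_alternating hB h, div_mul_cancel₀ _ (pow_ne_zero _ hq)]

variable {F₀}

theorem WittCount.fromBlocks {ι κ : Type*} [Fintype ι] [DecidableEq ι] [Fintype κ] [DecidableEq κ]
    {G : Matrix ι ι F} {H : Matrix κ κ F} {m n : ℕ} (hG : WittCount.{u} F₀ c σ G m)
    (hH : WittCount.{u} F₀ c σ H n) (hdet : G.det ≠ 0) (hι : Fintype.card ι = c.gamma * m)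
    (hn : 0 < n ∨ c.sign F H.det = 1) :
    WittCount.{u} F₀ c σ (Matrix.fromBlocks G 0 0 H) (m + n) := by
  intro V _ _ _ B hB r χ h
  have : Module.Finite F V := Module.Finite.of_finite
  rw [add_assoc] at h ⊢
  have hcompl (e : gramFrames B G) :=
    hH _ _ (hB.restrict _) r _ (hasType_complForm hB h e.2 hdet hι)
  rw [Nat.card_congr (gramFramesSumEquiv hB.isRefl G H), cast_card_sigma_of_card_eq hcompl,
    hG V B hB _ _ h, Matrix.det_fromBlocks_zero₂₁, sign_mul, ← mul_assoc χ]
  refine div_formOrder_mul_div_cancel c ?_ ?_ _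
  · rw [mul_pow, h.sq_eq_one hB.isRefl, one_mul, sq, sign_mul_self c hdet]
  · rcases Nat.eq_zero_or_pos n with rfl | hpos
    · rw [hn.resolve_left (lt_irrefl 0), mul_one, zero_add]
      exact Or.inr ⟨rfl, rfl⟩
    · exact Or.inl (Nat.add_pos_left hpos r)

variable (F₀)

theorem wittCount_zero {ι : Type*} [Fintype ι] [DecidableEq ι] [IsEmpty ι] (c : FormCase)
    (σ : F →+* F) (G : Matrix ι ι F) : WittCount.{u} F₀ c σ G 0 := by
  intro V _ _ _ B hB r χ h
  have hframes : gramFrames B G = Set.univ := Set.eq_univ_of_forall fun _ i => isEmptyElim i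
  rw [zero_add] at h ⊢
  rw [hframes, Nat.card_congr (Equiv.Set.univ _), Nat.card_unique, Matrix.det_isEmpty, sign_one,
    mul_one, Nat.cast_one]
  exact (div_self (formOrder_ne_zero c (h.sq_eq_one hB.isRefl) h.pos_or_eq_one)).symm

theorem exists_wittCount_one (c : FormCase) (σ : F →+* F) (hF : c = symmetric → ringChar F ≠ 2)
    {ψ : ℤ} (hψ : ψ ∈ c.Sign) :
    ∃ (ι : Type) (_ : Fintype ι) (_ : DecidableEq ι) (G : Matrix ι ι F),
      Fintype.card ι = c.gamma ∧ G.det ≠ 0 ∧ c.sign F G.det = ψ ∧ WittCount.{u} F₀ c σ G 1 := by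
  cases c with
  | hermitian =>
    exact ⟨Unit, inferInstance, inferInstance, singleGram 1, rfl, by simp, Eq.symm hψ,
      wittCount_hermitian_singleGram_one F₀ σ⟩
  | symmetric =>
    obtain ⟨a, ha⟩ : ∃ a : F, quadraticChar F a = ψ := by
      rcases hψ with rfl | rfl
      · exact ⟨1, map_one _⟩
      · exact quadraticChar_exists_neg_one (hF rfl)
    have ha0 : a ≠ 0 := by
      rintro rfl
      rcases hψ with rfl | rfl <;> simp at ha
    exact ⟨Unit, inferInstance, inferInstance, singleGram a, rfl, by simpa using ha0,
      by simpa [sign] using ha, wittCount_symmetric_singleGram F₀ σ ha0⟩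
  | alternating =>
    exact ⟨Fin 2, inferInstance, inferInstance, symplecticGram F, rfl, by simp, Eq.symm hψ,
      wittCount_symplecticGram F₀ σ⟩

theorem one_mem_sign (c : FormCase) : (1 : ℤ) ∈ c.Sign := by
  cases c <;> simp [Sign]

theorem exists_wittCount (c : FormCase) (σ : F →+* F) (hF : c = symmetric → ringChar F ≠ 2)
    {n : ℕ} {ψ : ℤ} (hψ : ψ ∈ c.Sign) (hn : 0 < n ∨ ψ = 1) :
    ∃ (ι : Type) (_ : Fintype ι) (_ : DecidableEq ι) (G : Matrix ι ι F),
      Fintype.card ι = c.gamma * n ∧ G.det ≠ 0 ∧ c.sign F G.det = ψ ∧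
        WittCount.{u} F₀ c σ G n := by
  induction n generalizing ψ with
  | zero =>
    exact ⟨Empty, inferInstance, inferInstance, 0, rfl, by simp,
      by simp [sign_one, hn.resolve_left (lt_irrefl 0)], wittCount_zero F₀ c σ _⟩
  | succ n ih =>
    obtain ⟨ι, _, _, G, hι, hdetG, hsignG, hG⟩ := exists_wittCount_one F₀ c σ hF hψ
    obtain ⟨κ, _, _, H, hκ, hdetH, hsignH, hH⟩ := ih (one_mem_sign c) (Or.inr rfl)
    refine ⟨ι ⊕ κ, inferInstance, inferInstance, Matrix.fromBlocks G 0 0 H, ?_, ?_, ?_, ?_⟩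
    · rw [Fintype.card_sum, hι, hκ, mul_add_one, add_comm]
    · rw [Matrix.det_fromBlocks_zero₂₁]
      exact mul_ne_zero hdetG hdetH
    · rw [Matrix.det_fromBlocks_zero₂₁, sign_mul, hsignG, hsignH, mul_one]
    · rw [add_comm]
      exact hG.fromBlocks hH hdetG (by rw [hι, mul_one]) (Or.inr hsignH)

end WittCount

variable {F₀ F : Type*} {V : Type u} [Field F₀] [Fintype F₀] [Field F] [Algebra F₀ F] [Fintype F]
  [DecidableEq F] [AddCommGroup V] [Module F V] [Finite V] {c : FormCase} {σ : F →+* F}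
  {B : V →ₛₗ[σ] V →ₗ[F] F} {n l m : ℕ} {χ ψ : ℤ}

theorem card_mixedFrames_eq_div {κ : Type*} [Fintype κ] [DecidableEq κ] {G : Matrix κ κ F}
    (hB : c.IsForm F₀ σ B) (hV : c.HasType B (n + (l + 2 / c.gamma * m)) χ)
    (hW : WittCount.{u} F₀ c σ G n) (hκ : Fintype.card κ = c.gamma * n) (hG : G.det ≠ 0) :
    (Nat.card (MixedFrames B G m) : ℚ) = formOrder F₀ F c (n + (l + 2 / c.gamma * m)) χ /
      formOrder F₀ F c l (χ * c.sign F G.det * c.sign F (-1) ^ m) /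
        unipotentOrder c (Fintype.card F₀) (Fintype.card F) l m := by
  have : Module.Finite F V := Module.Finite.of_finite
  have hcompl (e : gramFrames B G) :=
    card_isoFrames (hB.restrict _) (hasType_complForm hB hV e.2 hG hκ)
  rw [cast_card_sigma_of_card_eq hcompl, hW _ _ hB _ _ hV, mul_div_assoc']
  congr 1
  refine div_formOrder_mul_div_cancel c ?_ ?_ _
  · rw [mul_pow, hV.sq_eq_one hB.isRefl, one_mul, sq, sign_mul_self c hG]
  · exact pos_or_mul_sign_pow_eq c l m _

theorem card_gramFrames_quotientForm (hB : c.IsForm F₀ σ B) {ι : Type*} [Fintype ι]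
    [DecidableEq ι] {G : Matrix ι ι F} (hW : WittCount.{u} F₀ c σ G n) {N : Submodule F V}
    (hN : c.HasType (quotientForm B hB.isRefl N) n (c.sign F G.det)) :
    (Nat.card (gramFrames (quotientForm B hB.isRefl N) G) : ℚ) =
      formOrder F₀ F c n (c.sign F G.det) := by
  have : Finite (N ⧸ (formRadical B N).submoduleOf N) :=
    Finite.of_surjective _ (Submodule.mkQ_surjective _)
  rw [hW _ _ (hB.quotient N) 0 _ hN, hN.mul_self_eq_one (isRefl_quotientForm hB.isRefl N),
    formOrder, formOrder, isomOrder_zero_one, div_one, add_zero]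

theorem card_typedSubspaces (hB : c.IsForm F₀ σ B)
    (hV : c.HasType B (n + (l + 2 / c.gamma * m)) χ) (hψ : ψ ∈ c.Sign) :
    (Nat.card (TypedSubspaces c B hB.isRefl m n ψ) : ℚ) =
      formOrder F₀ F c (n + (l + 2 / c.gamma * m)) χ /
        (formOrder F₀ F c n ψ * formOrder F₀ F c l (χ * ψ * c.sign F (-1) ^ m) *
          glOrder (Fintype.card F) m *
            unipotentOrder c (Fintype.card F₀) (Fintype.card F) (n + l) m) := by
  by_cases hn : 0 < n ∨ ψ = 1
  · have hF : c = symmetric → ringChar F ≠ 2 := by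
      rintro rfl
      exact hB.2.1
    obtain ⟨κ, _, _, G, hκ, hG, rfl, hW⟩ := exists_wittCount.{u} F₀ c σ hF hψ hn
    have hcount := card_mixedFrames (m := m) hB.isRefl hG hκ fun N =>
      card_gramFrames_quotientForm hB hW N.2.2
    have hq : (1 : ℚ) < Fintype.card F := Nat.one_lt_cast.2 Fintype.one_lt_card
    have hq0 : (Fintype.card F : ℚ) ≠ 0 := (zero_lt_one.trans hq).ne'
    have hO : formOrder F₀ F c n (c.sign F G.det) ≠ 0 :=
      formOrder_ne_zero c (by rw [sq, sign_mul_self c hG]) hn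
    have hfiber := mul_ne_zero (mul_ne_zero hO (pow_ne_zero (m * (c.gamma * n)) hq0))
      (glOrder_ne_zero hq m)
    rw [eq_div_of_mul_eq hfiber hcount.symm, card_mixedFrames_eq_div hB hV hW hκ hG, div_div,
      div_div, ← unipotentOrder_mul_pow hB.card_eq_sq]
    ring
  · obtain ⟨hn, hψ1⟩ := not_or.1 hn
    obtain rfl := Nat.eq_zero_of_not_pos hn
    have : IsEmpty (TypedSubspaces c B hB.isRefl m 0 ψ) := ⟨fun N => hψ1 N.2.2.eq_one_of_zero⟩
    rw [Nat.card_of_isEmpty, formOrder_zero_of_ne_one hψ hψ1, Nat.cast_zero, zero_mul, zero_mul,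
      zero_mul, div_zero]

end FormCase

end GramCounts

/-! ### The formula in terms of orders of isometry groups -/

section Formula

theorem choose_two_add (a b : ℕ) : (a + b).choose 2 = a.choose 2 + b.choose 2 + a * b := by
  induction b with
  | zero => simp
  | succ b ih =>
    rw [← add_assoc, Nat.choose_succ_succ' (a + b) 1, Nat.choose_succ_succ' b 1, ih,
      Nat.choose_one_right, Nat.choose_one_right]
    ring

theorem mul_self_eq_add_two_mul_choose_two (m : ℕ) : m * m = m + 2 * m.choose 2 := by
  induction m with
  | zero => rfl
  | succ m ih =>
    rw [Nat.choose_succ_succ' m 1, Nat.choose_one_right]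
    linarith

theorem choose_two_add_two_mul (n l m : ℕ) :
    (n + (l + 2 * m)).choose 2 =
      n.choose 2 + l.choose 2 + n * l + (2 * (m * (n + l) + 2 * m.choose 2) + m) := by
  rw [two_mul m, choose_two_add, choose_two_add, choose_two_add, mul_self_eq_add_two_mul_choose_two]
  ring

theorem orthogonalExponent_succ (r : ℕ) :
    orthogonalExponent (r + 1) = orthogonalExponent r + r / 2 := by
  rw [orthogonalExponent, orthogonalExponent, show (r + 1 + 1) / 2 = r / 2 + 1 by omega,
    Nat.choose_succ_succ' (r / 2) 1, Nat.choose_one_right]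
  ring

theorem orthogonalExponent_add (a b : ℕ) :
    orthogonalExponent (a + b) = orthogonalExponent a + orthogonalExponent b + a * b / 2 := by
  induction b with
  | zero => simp [orthogonalExponent]
  | succ b ih =>
    have hparity : a * b / 2 + (a + b) / 2 = b / 2 + (a * b + a) / 2 := by
      have hmod := Nat.mul_mod a b 2
      rcases Nat.mod_two_eq_zero_or_one a with ha | ha <;>
        rcases Nat.mod_two_eq_zero_or_one b with hb | hb <;> rw [ha, hb] at hmod <;> omega
    rw [← add_assoc, orthogonalExponent_succ, orthogonalExponent_succ, ih, mul_add_one]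
    omega

theorem orthogonalExponent_add_two_mul (n l m : ℕ) :
    orthogonalExponent (n + (l + 2 * m)) = orthogonalExponent n + orthogonalExponent l +
      n * l / 2 + (m * (n + l) + 2 * m.choose 2) := by
  have hm : orthogonalExponent (2 * m) = 2 * m.choose 2 := by
    rw [orthogonalExponent, show 2 * m / 2 = m by omega, show (2 * m + 1) / 2 = m by omega, two_mul]
  rw [← add_assoc, orthogonalExponent_add, orthogonalExponent_add, hm, mul_left_comm,
    Nat.mul_div_cancel_left _ two_pos]
  ring

variable {q₀ q : ℕ}

theorem unipotentOrder_hermitian_eq_neg_pow (q₀ q k m : ℕ) :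
    unipotentOrder .hermitian q₀ q k m =
      (-1) ^ m * (-(q₀ : ℚ)) ^ (2 * (m * k + m.choose 2) + m) := by
  rw [unipotentOrder, pow_add, pow_add, pow_mul, pow_mul, neg_sq, mul_left_comm, ← mul_pow (-1),
    neg_one_mul, neg_neg]

theorem formulaQ_hermitian_eq_div (hq₀ : 1 < q₀) (ε χ ψ₁ ψ₂ : ℤ) (n l m : ℕ) :
    formulaQ .hermitian q₀ (q₀ ^ 2) ε (n + (l + 2 * m)) χ n ψ₁ m l ψ₂ =
      isomOrder .hermitian q₀ (q₀ ^ 2) ε (n + (l + 2 * m)) χ /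
        (isomOrder .hermitian q₀ (q₀ ^ 2) ε n ψ₁ * isomOrder .hermitian q₀ (q₀ ^ 2) ε l ψ₂ *
          glOrder ((q₀ ^ 2 : ℕ) : ℚ) m * unipotentOrder .hermitian q₀ (q₀ ^ 2) (n + l) m) := by
  have hx : -(q₀ : ℚ) ≠ 0 := neg_ne_zero.2 (Nat.cast_ne_zero.2 (by omega))
  have hfalln := qFalling_neg_ne_zero hq₀ n
  have hfalll := qFalling_neg_ne_zero hq₀ l
  have hGL := qFalling_sq_ne_zero hq₀ m
  have hsign (k : ℕ) : ((-1 : ℚ) ^ k) ^ 2 = 1 := by rw [pow_right_comm, neg_one_sq, one_pow]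
  have hsignr : (-1 : ℚ) ^ (n + (l + 2 * m)) = (-1) ^ n * (-1) ^ l := by
    rw [pow_add, pow_add, pow_mul, neg_one_sq, one_pow, mul_one]
  have hsign0 (k : ℕ) : (-1 : ℚ) ^ k ≠ 0 := pow_ne_zero k (neg_ne_zero.2 one_ne_zero)
  have hn0 := hsign0 n
  have hl0 := hsign0 l
  have hm0 := hsign0 m
  have hm := hsign m
  rw [formulaQ, if_neg (by omega)]
  simp only [isomOrder, glOrder, Nat.cast_pow, Int.toNat_natCast, choose_two_add_two_mul,
    unipotentOrder_hermitian_eq_neg_pow, hsignr]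
  generalize qFalling ((q₀ : ℚ) ^ 2) m = y at *
  rw [← neg_sq (q₀ : ℚ)]
  generalize -(q₀ : ℚ) = x at *
  generalize (-1 : ℚ) ^ n = s at *
  generalize (-1 : ℚ) ^ l = t at *
  generalize (-1 : ℚ) ^ m = u at *
  field_simp
  simp only [hm]
  ring

theorem formulaQ_symmetric_eq_div (hq : 1 < q) (ε χ ψ₁ ψ₂ : ℤ) (n l m : ℕ) :
    formulaQ .symmetric q₀ q ε (n + (l + 2 * m)) χ n ψ₁ m l ψ₂ =
      isomOrder .symmetric q₀ q ε (n + (l + 2 * m)) χ /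
        (isomOrder .symmetric q₀ q ε n ψ₁ * isomOrder .symmetric q₀ q ε l ψ₂ * glOrder q m *
          unipotentOrder .symmetric q₀ q (n + l) m) := by
  have hfall := qFalling_sq_ne_zero hq
  have hfalln := hfall (n / 2)
  have hfalll := hfall (l / 2)
  have hGL := qFalling_cast_ne_zero hq m
  rw [formulaQ, if_neg (by omega)]
  simp only [isomOrder, glOrder, unipotentOrder, Int.toNat_natCast, orthogonalExponent_add_two_mul]
  simp only [div_eq_mul_inv _ (eFactor _ _ _ _), mul_inv, inv_inv, div_eq_mul_inv _ (_ * _)]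
  generalize (eFactor q ε (n + (l + 2 * m)) χ)⁻¹ = E
  field_simp
  ring

theorem formulaQ_alternating_eq_div (hq : 1 < q) (ε χ ψ₁ ψ₂ : ℤ) (n l m : ℕ) :
    formulaQ .alternating q₀ q ε (n + (l + 1 * m)) χ n ψ₁ m l ψ₂ =
      isomOrder .alternating q₀ q ε (n + (l + 1 * m)) χ /
        (isomOrder .alternating q₀ q ε n ψ₁ * isomOrder .alternating q₀ q ε l ψ₂ * glOrder q m *
          unipotentOrder .alternating q₀ q (n + l) m) := by
  have hfall := qFalling_sq_ne_zero hq
  have hfalln := hfall n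
  have hfalll := hfall l
  have hGL := qFalling_cast_ne_zero hq m
  have hexp : (n + (l + 1 * m)) ^ 2 = n ^ 2 + l ^ 2 + 2 * n * l + 2 * m * (n + l) +
      (m + 2 * m.choose 2) := by
    rw [← mul_self_eq_add_two_mul_choose_two]
    ring
  rw [formulaQ, if_neg (by omega)]
  simp only [isomOrder, glOrder, unipotentOrder, Int.toNat_natCast, hexp, Nat.choose_succ_succ' m 1,
    Nat.choose_one_right]
  field_simp
  ring

theorem formulaQ_eq_div (c : FormCase) (hq₀ : 1 < q₀) (hq : 1 < q)
    (hc : c = .hermitian → q = q₀ ^ 2) (ε χ ψ₁ ψ₂ : ℤ) (n l m : ℕ) :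
    formulaQ c q₀ q ε (n + (l + 2 / c.gamma * m)) χ n ψ₁ m l ψ₂ =
      isomOrder c q₀ q ε (n + (l + 2 / c.gamma * m)) χ /
        (isomOrder c q₀ q ε n ψ₁ * isomOrder c q₀ q ε l ψ₂ * glOrder q m *
          unipotentOrder c q₀ q (n + l) m) := by
  cases c with
  | hermitian =>
    obtain rfl := hc rfl
    exact formulaQ_hermitian_eq_div hq₀ ε χ ψ₁ ψ₂ n l m
  | symmetric => exact formulaQ_symmetric_eq_div hq ε χ ψ₁ ψ₂ n l m
  | alternating => exact formulaQ_alternating_eq_div hq ε χ ψ₁ ψ₂ n l m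

end Formula

/-! ### Vanishing -/

section Vanishing

variable {F V : Type*} [Field F] [AddCommGroup V] [Module F V] {σ : F →+* F}
  {B : V →ₛₗ[σ] V →ₗ[F] F}

theorem finrank_add_finrank_orthogonalBilin_le [FiniteDimensional F V] (hB : B.SeparatingRight)
    (N : Submodule F V) :
    Module.finrank F N + Module.finrank F (N.orthogonalBilin B) ≤ Module.finrank F V := by
  obtain ⟨W, hW⟩ := N.exists_isCompl
  let b := Module.finBasis F W
  let pairing : N.orthogonalBilin B →ₗ[F] Fin (Module.finrank F W) → F :=
    LinearMap.pi fun k => (B (b k)).domRestrict _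
  have hinj : Function.Injective pairing := by
    refine (injective_iff_map_eq_zero pairing).2 fun x hx => Subtype.ext (hB x fun y => ?_)
    have hWx : (B.flip x).domRestrict W = 0 := b.ext fun k => congrFun hx k
    obtain ⟨u, hu, w, hw, rfl⟩ :=
      Submodule.mem_sup.1 (hW.sup_eq_top ▸ Submodule.mem_top : y ∈ N ⊔ W)
    have hux : B u x = 0 := x.2 u hu
    have hwx : B w x = 0 := LinearMap.congr_fun hWx ⟨w, hw⟩
    rw [map_add, LinearMap.add_apply, hux, hwx, add_zero]
  have hle := LinearMap.finrank_le_finrank_of_injective hinj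
  rw [Module.finrank_fin_fun] at hle
  have hadd := Submodule.finrank_add_eq_of_isCompl hW
  omega

theorem FormCase.add_le_of_hasType_quotientForm [Fintype F] [DecidableEq F]
    {c : FormCase} {r n m : ℕ} {χ ψ : ℤ} (hV : c.HasType B r χ) (hB : B.IsRefl)
    {N : Submodule F V} (hm : Module.finrank F (formRadical B N) = m)
    (hN : c.HasType (quotientForm B hB N) n ψ) : n + 2 / c.gamma * m ≤ r := by
  have : FiniteDimensional F V := Module.Basis.finiteDimensional_of_finite hV.2.choose
  have hle := finrank_add_finrank_orthogonalBilin_le hV.1.2 N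
  have hradical : Module.finrank F (formRadical B N) ≤ Module.finrank F (N.orthogonalBilin B) :=
    Submodule.finrank_mono inf_le_right
  have hquotient := finrank_quotient_add_finrank_formRadical (B := B) N
  rw [hN.finrank_eq] at hquotient
  rw [hV.finrank_eq] at hle
  cases c <;> simp only [FormCase.gamma, one_mul, Nat.div_one, Nat.div_self two_pos] at * <;> omega

end Vanishing

theorem mainTheorem6 {F₀ F V : Type*} [Field F₀] [Fintype F₀] [Field F] [Fintype F]
    [DecidableEq F] [Algebra F₀ F] [AddCommGroup V] [Module F V] [FiniteDimensional F V]
    (c : FormCase) (σ : F →+* F) (B : V →ₛₗ[σ] V →ₗ[F] F) (hB : c.IsForm F₀ σ B)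
    (r : ℕ) (χ : ℤ) (hV : c.HasType B r χ)
    (m n : ℕ) (hm : m ≤ r) (hn : n ≤ r) (ψ₁ : ℤ) (hψ₁ : ψ₁ ∈ c.Sign)
    (l : ℤ) (hl : l = r - n - (2 / c.gamma : ℕ) * m)
    (ψ₂ : ℤ) (hψ₂ : ψ₂ = χ * ψ₁ * c.sign F (-1) ^ m) :
    (Nat.card {N : Submodule F V // Module.finrank F (formRadical B N) = m ∧
        c.HasType (quotientForm B hB.isRefl N) n ψ₁} : ℚ) =
      formulaQ c (Fintype.card F₀) (Fintype.card F) (c.sign F (-1)) r χ n ψ₁ m l ψ₂ := by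
  have : Finite V := Module.finite_of_finite F
  rcases lt_or_ge l 0 with hneg | hnonneg
  · have hempty : IsEmpty {N : Submodule F V // Module.finrank F (formRadical B N) = m ∧
        c.HasType (quotientForm B hB.isRefl N) n ψ₁} := by
      refine ⟨fun N => hneg.not_ge ?_⟩
      have hle := FormCase.add_le_of_hasType_quotientForm hV hB.isRefl N.2.1 N.2.2
      omega
    rw [Nat.card_of_isEmpty, Nat.cast_zero, formulaQ.eq_def, if_pos hneg]
  · obtain ⟨k, rfl⟩ := Int.eq_ofNat_of_zero_le hnonneg
    obtain rfl : r = n + (k + 2 / c.gamma * m) := by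
      omega
    rw [formulaQ_eq_div c Fintype.one_lt_card Fintype.one_lt_card hB.card_eq_sq, hψ₂]
    exact FormCase.card_typedSubspaces hB hV hψ₁
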